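/- Let $\mathbb K$ be an algebraically closed field, let $n>2$ be an integer and let $q\in\mathbb K$ be a primitive $n$-th root of unity. Let $A_n(q)$ be the Taft Hopf algebra generated by $g,x$ with relations $g^n=1$, $x^n=0$, $xg=qgx$, and with $\Delta(g)=g\otimes g$, $\Delta(x)=x\otimes g+1\otimes x$, $\varepsilon(g)=1$, $\varepsilon(x)=0$, $S(g)=g^{n-1}$, $S(x)=-xg^{n-1}$; let $A_n(q^{-1})$ be the analogous Hopf algebra with generators $g_1,x_1$ and $q^{-1}$ in place of $q$. Let $\mathcal H_n(q)=A_n(q)\otimes A_n(q^{-1})$, and put $a=1\otimes x_1$, $b=1\otimes g_1$, $c=g\otimes 1$, $d=x\otimes 1$. For integers $i,j$ (modulo $n$) let $S_{i,j}$ be the one-dimensional left $\mathcal H_n(q)$-module on which $b$ acts by $q^i$, $c$ acts by $q^j$, and $a,d$ act by $0$; let $P_{0,0}$ be the projective cover of $S_{0,0}$. For a Hopf algebra $H$ over $\mathbb K$, the Green ring $r(H)$ is the abelian group generated by the isomorphism classes $[M]$ of finite-dimensional left $H$-modules modulo the relations $[M\oplus N]=[M]+[N]$, with multiplication $[M][N]=[M\otimes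 N]$, and the projective class ring $r_p(H)$ is the subring of $r(H)$ generated by the classes of the projective modules and of the simple modules. Then the projective cover $P_{0,0}$ exists as a finite-dimensional module, and there is a ring isomorphism $$\mathbb Z[x,y,z]\Big/\Big(x^n-1,\ y^n-1,\ z^2-\sum_{i,j=0}^{n-1}x^iy^jz\Big)\;\cong\; r_p(\mathcal H_n(q))$$ which sends the classes of $x,y,z$ to $[S_{1,0}]$, $[S_{0,1}]$ and $[P_{0,0}]$, respectively. -/

import Mathlib

open scoped TensorProduct

universe u

noncomputable section

/-! ### Finite-dimensional modules over a bialgebra -/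

/-- A finite-dimensional left `H`-module over the field `K`. -/
structure FDMod (K H : Type u) [Field K] [Ring H] [Bialgebra K H] where
  carrier : Type u
  [addCommGroup : AddCommGroup carrier]
  [moduleBase : Module K carrier]
  [module : Module H carrier]
  [isScalarTower : IsScalarTower K H carrier]
  [finite : Module.Finite K carrier]

namespace FDMod

attribute [instance] addCommGroup moduleBase module isScalarTower finite

variable {K H : Type u} [Field K] [Ring H] [Bialgebra K H]

instance : CoeSort (FDMod K H) (Type u) := ⟨carrier⟩

/-- The `H`-module given by an algebra homomorphism `H → End V`. -/
def ofRep {V : Type u} [AddCommGroup V] [Module K V] [Module.Finite K V]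
    (ρ : H →ₐ[K] Module.End K V) : FDMod K H where
  carrier := V
  module := Module.compHom V ρ.toRingHom
  isScalarTower := by
    let _ : Module H V := Module.compHom V ρ.toRingHom
    refine ⟨fun k h v => ?_⟩
    change ρ (k • h) v = k • ρ h v
    rw [map_smul, LinearMap.smul_apply]

/-- The representation `H → End M` of a module `M`. -/
def rep (M : FDMod K H) : H →ₐ[K] Module.End K M := Algebra.lsmul K K M

/-- The one-dimensional module on which `H` acts by a character. -/
def ofCharacter (χ : H →ₐ[K] K) : FDMod K H :=
  ofRep ((Algebra.lsmul K K K : K →ₐ[K] Module.End K K).comp χ)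

/-- The trivial module: `H` acts through the counit. -/
def trivial (K H : Type u) [Field K] [Ring H] [Bialgebra K H] : FDMod K H :=
  ofCharacter (Bialgebra.counitAlgHom K H)

/-- The direct sum `M ⊕ N`. -/
def directSum (M N : FDMod K H) : FDMod K H where
  carrier := M × N

section tensorAction

variable {U V W : Type u} [AddCommGroup U] [Module K U] [AddCommGroup V] [Module K V]
  [AddCommGroup W] [Module K W]

/-- Given representations of `H` on `V` and `W`, the algebra `H ⊗ H` acts on `V ⊗ W` by
`(h ⊗ h') (v ⊗ w) = h v ⊗ h' w`. -/
def tensorAction (ρ : H →ₐ[K] Module.End K V) (σ : H →ₐ[K] Module.End K W) :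
    H ⊗[K] H →ₐ[K] Module.End K (V ⊗[K] W) :=
  (Module.endTensorEndAlgHom (R := K) (S := K) (A := K)).comp (Algebra.TensorProduct.map ρ σ)

@[simp]
theorem tensorAction_tmul_tmul (ρ : H →ₐ[K] Module.End K V) (σ : H →ₐ[K] Module.End K W)
    (h h' : H) (v : V) (w : W) :
    tensorAction ρ σ (h ⊗ₜ h') (v ⊗ₜ w) = ρ h v ⊗ₜ σ h' w := rfl

/-- The tensor product of two representations, where `h` acts on `V ⊗ W` through its
comultiplication: `h (v ⊗ w) = ∑ h₁ v ⊗ h₂ w`. -/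
def tensorRep (ρ : H →ₐ[K] Module.End K V) (σ : H →ₐ[K] Module.End K W) :
    H →ₐ[K] Module.End K (V ⊗[K] W) :=
  (tensorAction ρ σ).comp (Bialgebra.comulAlgHom K H)

theorem tensorRep_apply (ρ : H →ₐ[K] Module.End K V) (σ : H →ₐ[K] Module.End K W) (h : H) :
    tensorRep ρ σ h = tensorAction ρ σ (Coalgebra.comul h) := rfl

theorem tensorRep_congr {V' W' : Type u} [AddCommGroup V'] [Module K V'] [AddCommGroup W']
    [Module K W'] (ρ : H →ₐ[K] Module.End K V) (σ : H →ₐ[K] Module.End K W)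
    (ρ' : H →ₐ[K] Module.End K V') (σ' : H →ₐ[K] Module.End K W')
    (e : V ≃ₗ[K] V') (f : W ≃ₗ[K] W') (he : ∀ h v, e (ρ h v) = ρ' h (e v))
    (hf : ∀ h w, f (σ h w) = σ' h (f w)) (h : H) (m : V ⊗[K] W) :
    TensorProduct.congr e f (tensorRep ρ σ h m) =
      tensorRep ρ' σ' h (TensorProduct.congr e f m) := by
  rw [tensorRep_apply, tensorRep_apply]
  generalize (Coalgebra.comul h : H ⊗[K] H) = t
  induction t with
  | zero => simp
  | add s t hs ht => simp only [map_add, LinearMap.add_apply, hs, ht]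
  | tmul a b =>
    induction m with
    | zero => simp
    | add s t hs ht => simp only [map_add, hs, ht]
    | tmul x y => simp [he, hf]

theorem tensorRep_assoc (ρ : H →ₐ[K] Module.End K U) (σ : H →ₐ[K] Module.End K V)
    (τ : H →ₐ[K] Module.End K W) (h : H) (m : (U ⊗[K] V) ⊗[K] W) :
    TensorProduct.assoc K U V W (tensorRep (tensorRep ρ σ) τ h m) =
      tensorRep ρ (tensorRep σ τ) h (TensorProduct.assoc K U V W m) := by
  let Θ : H ⊗[K] (H ⊗[K] H) →ₐ[K] Module.End K (U ⊗[K] (V ⊗[K] W)) :=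
    (Module.endTensorEndAlgHom (R := K) (S := K) (A := K)).comp
      (Algebra.TensorProduct.map ρ (tensorAction σ τ))
  have hΘ : ∀ (a : H) (t : H ⊗[K] H) (u : U) (x : V ⊗[K] W),
      Θ (a ⊗ₜ t) (u ⊗ₜ x) = ρ a u ⊗ₜ tensorAction σ τ t x := fun _ _ _ _ => rfl
  have key1 : ∀ (t : H ⊗[K] H) (m : (U ⊗[K] V) ⊗[K] W),
      TensorProduct.assoc K U V W (tensorAction (tensorRep ρ σ) τ t m) =
      Θ (TensorProduct.assoc K H H H ((Coalgebra.comul (R := K)).rTensor H t))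
        (TensorProduct.assoc K U V W m) := by
    intro t m
    induction t with
    | zero => simp
    | add s t hs ht => simp only [map_add, LinearMap.add_apply, hs, ht]
    | tmul a b =>
      induction m with
      | zero => simp
      | add s t hs ht => simp only [map_add, hs, ht]
      | tmul x n =>
        rw [tensorAction_tmul_tmul, tensorRep_apply, LinearMap.rTensor_tmul]
        generalize (Coalgebra.comul a : H ⊗[K] H) = s
        induction s with
        | zero => simp
        | add s t hs ht => simp only [map_add, LinearMap.add_apply, TensorProduct.add_tmul, hs, ht]
        | tmul c d =>
          induction x with
          | zero => simp
          | add s t hs ht => simp only [map_add, TensorProduct.add_tmul, hs, ht]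
          | tmul l m => simp [hΘ]
  have key2 : ∀ (t : H ⊗[K] H) (m : U ⊗[K] (V ⊗[K] W)),
      tensorAction ρ (tensorRep σ τ) t m = Θ ((Coalgebra.comul (R := K)).lTensor H t) m := by
    intro t m
    induction t with
    | zero => simp
    | add s t hs ht => simp only [map_add, LinearMap.add_apply, hs, ht]
    | tmul a b =>
      induction m with
      | zero => simp
      | add s t hs ht => simp only [map_add, hs, ht]
      | tmul l x => simp [hΘ, tensorRep_apply]
  rw [tensorRep_apply, tensorRep_apply, key1, key2, Coalgebra.coassoc_apply]

theorem lid_tensorRep (σ : H →ₐ[K] Module.End K V) (h : H) (m : K ⊗[K] V) :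
    TensorProduct.lid K V (tensorRep
      ((Algebra.lsmul K K K : K →ₐ[K] Module.End K K).comp (Bialgebra.counitAlgHom K H)) σ h m) =
      σ h (TensorProduct.lid K V m) := by
  have key : ∀ (t : H ⊗[K] H) (m : K ⊗[K] V),
      TensorProduct.lid K V (tensorAction
        ((Algebra.lsmul K K K : K →ₐ[K] Module.End K K).comp (Bialgebra.counitAlgHom K H)) σ t m) =
      σ (TensorProduct.lid K H ((Coalgebra.counit (R := K)).rTensor H t))
        (TensorProduct.lid K V m) := by
    intro t m
    induction t with
    | zero => simp
    | add s t hs ht => simp only [map_add, LinearMap.add_apply, hs, ht]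
    | tmul a b =>
      induction m with
      | zero => simp
      | add s t hs ht => simp only [map_add, hs, ht]
      | tmul k x => simp [mul_smul, smul_comm k]
  rw [tensorRep_apply, key, Coalgebra.rTensor_counit_comul, TensorProduct.lid_tmul, one_smul]

theorem rid_tensorRep (σ : H →ₐ[K] Module.End K V) (h : H) (m : V ⊗[K] K) :
    TensorProduct.rid K V (tensorRep σ
      ((Algebra.lsmul K K K : K →ₐ[K] Module.End K K).comp (Bialgebra.counitAlgHom K H)) h m) =
      σ h (TensorProduct.rid K V m) := by
  have key : ∀ (t : H ⊗[K] H) (m : V ⊗[K] K),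
      TensorProduct.rid K V (tensorAction σ
        ((Algebra.lsmul K K K : K →ₐ[K] Module.End K K).comp (Bialgebra.counitAlgHom K H)) t m) =
      σ (TensorProduct.rid K H ((Coalgebra.counit (R := K)).lTensor H t))
        (TensorProduct.rid K V m) := by
    intro t m
    induction t with
    | zero => simp
    | add s t hs ht => simp only [map_add, LinearMap.add_apply, hs, ht]
    | tmul a b =>
      induction m with
      | zero => simp
      | add s t hs ht => simp only [map_add, hs, ht]
      | tmul x k => simp [mul_smul, smul_comm k]
  rw [tensorRep_apply, key, Coalgebra.lTensor_counit_comul, TensorProduct.rid_tmul, one_smul]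

/-- The direct sum of two representations. -/
def prodRep (ρ : H →ₐ[K] Module.End K V) (σ : H →ₐ[K] Module.End K W) :
    H →ₐ[K] Module.End K (V × W) :=
  (LinearMap.prodMapAlgHom K V W).comp (ρ.prod σ)

theorem prodRep_apply (ρ : H →ₐ[K] Module.End K V) (σ : H →ₐ[K] Module.End K W) (h : H)
    (v : V × W) : prodRep ρ σ h v = (ρ h v.1, σ h v.2) := rfl

theorem prodRight_tensorRep (ρ : H →ₐ[K] Module.End K U) (σ : H →ₐ[K] Module.End K V)
    (τ : H →ₐ[K] Module.End K W) (h : H) (m : U ⊗[K] (V × W)) :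
    TensorProduct.prodRight K K U V W (tensorRep ρ (prodRep σ τ) h m) =
      prodRep (tensorRep ρ σ) (tensorRep ρ τ) h (TensorProduct.prodRight K K U V W m) := by
  rw [prodRep_apply, tensorRep_apply, tensorRep_apply, tensorRep_apply]
  generalize (Coalgebra.comul h : H ⊗[K] H) = t
  induction t with
  | zero => simp only [map_zero, LinearMap.zero_apply, Prod.fst_zero, Prod.snd_zero,
        Prod.mk_zero_zero]
  | add s t hs ht => simp only [map_add, LinearMap.add_apply, hs, ht, Prod.mk_add_mk]
  | tmul a b =>
    induction m with
    | zero => simp only [map_zero, LinearMap.zero_apply, Prod.fst_zero, Prod.snd_zero,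
        Prod.mk_zero_zero]
    | add s t hs ht => simp only [map_add, hs, ht, Prod.fst_add, Prod.snd_add, Prod.mk_add_mk]
    | tmul l x => simp [prodRep_apply]

theorem prodLeft_tensorRep (ρ : H →ₐ[K] Module.End K U) (σ : H →ₐ[K] Module.End K V)
    (τ : H →ₐ[K] Module.End K W) (h : H) (m : (U × V) ⊗[K] W) :
    TensorProduct.prodLeft K K U V W (tensorRep (prodRep ρ σ) τ h m) =
      prodRep (tensorRep ρ τ) (tensorRep σ τ) h (TensorProduct.prodLeft K K U V W m) := by
  rw [prodRep_apply, tensorRep_apply, tensorRep_apply, tensorRep_apply]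
  generalize (Coalgebra.comul h : H ⊗[K] H) = t
  induction t with
  | zero => simp only [map_zero, LinearMap.zero_apply, Prod.fst_zero, Prod.snd_zero,
        Prod.mk_zero_zero]
  | add s t hs ht => simp only [map_add, LinearMap.add_apply, hs, ht, Prod.mk_add_mk]
  | tmul a b =>
    induction m with
    | zero => simp only [map_zero, LinearMap.zero_apply, Prod.fst_zero, Prod.snd_zero,
        Prod.mk_zero_zero]
    | add s t hs ht => simp only [map_add, hs, ht, Prod.fst_add, Prod.snd_add, Prod.mk_add_mk]
    | tmul l x => rfl

end tensorAction

/-- The tensor product `M ⊗ N` over `K`, where `h` acts through its comultiplication: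
`h (m ⊗ n) = ∑ h₁ m ⊗ h₂ n`. -/
def tensor (M N : FDMod K H) : FDMod K H := ofRep (tensorRep M.rep N.rep)

/-- A `K`-linear bijection that commutes with `H` is an isomorphism of modules. -/
def isoOfLinearEquiv {M N : FDMod K H} (e : M ≃ₗ[K] N)
    (he : ∀ (h : H) (m : M), e (h • m) = h • e m) : M ≃ₗ[H] N :=
  { e with map_smul' := he }

theorem tensor_congr {M M' N N' : FDMod K H} (e : M ≃ₗ[H] M') (f : N ≃ₗ[H] N') :
    Nonempty (tensor M N ≃ₗ[H] tensor M' N') :=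
  ⟨isoOfLinearEquiv (M := tensor M N) (N := tensor M' N')
    (TensorProduct.congr (e.restrictScalars K) (f.restrictScalars K))
    (tensorRep_congr M.rep N.rep M'.rep N'.rep (e.restrictScalars K) (f.restrictScalars K)
      (fun h v => e.map_smul h v) (fun h v => f.map_smul h v))⟩

theorem tensor_assoc (L M N : FDMod K H) :
    Nonempty (tensor (tensor L M) N ≃ₗ[H] tensor L (tensor M N)) :=
  ⟨isoOfLinearEquiv (M := tensor (tensor L M) N) (N := tensor L (tensor M N))
    (TensorProduct.assoc K L M N) (tensorRep_assoc L.rep M.rep N.rep)⟩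

theorem trivial_tensor (M : FDMod K H) : Nonempty (tensor (trivial K H) M ≃ₗ[H] M) :=
  ⟨isoOfLinearEquiv (M := tensor (trivial K H) M) (TensorProduct.lid K M) (lid_tensorRep M.rep)⟩

theorem tensor_trivial (M : FDMod K H) : Nonempty (tensor M (trivial K H) ≃ₗ[H] M) :=
  ⟨isoOfLinearEquiv (M := tensor M (trivial K H)) (TensorProduct.rid K M) (rid_tensorRep M.rep)⟩

theorem tensor_directSum (L M N : FDMod K H) :
    Nonempty (tensor L (directSum M N) ≃ₗ[H] directSum (tensor L M) (tensor L N)) :=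
  ⟨isoOfLinearEquiv (M := tensor L (directSum M N)) (N := directSum (tensor L M) (tensor L N))
    (TensorProduct.prodRight K K L M N) (prodRight_tensorRep L.rep M.rep N.rep)⟩

theorem directSum_tensor (L M N : FDMod K H) :
    Nonempty (tensor (directSum L M) N ≃ₗ[H] directSum (tensor L N) (tensor M N)) :=
  ⟨isoOfLinearEquiv (M := tensor (directSum L M) N) (N := directSum (tensor L N) (tensor M N))
    (TensorProduct.prodLeft K K L M N) (prodLeft_tensorRep L.rep M.rep N.rep)⟩

/-- Isomorphism of `H`-modules. -/
instance isoSetoid (K H : Type u) [Field K] [Ring H] [Bialgebra K H] : Setoid (FDMod K H) where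
  r M N := Nonempty (M ≃ₗ[H] N)
  iseqv := ⟨fun _ => ⟨LinearEquiv.refl _ _⟩, fun ⟨e⟩ => ⟨e.symm⟩, fun ⟨e⟩ ⟨f⟩ => ⟨e.trans f⟩⟩

end FDMod

/-! ### The Green ring and the projective class ring -/

/-- Isomorphism classes of finite-dimensional `H`-modules. -/
def IsoClass (K H : Type u) [Field K] [Ring H] [Bialgebra K H] : Type (u + 1) :=
  Quotient (FDMod.isoSetoid K H)

namespace IsoClass

variable {K H : Type u} [Field K] [Ring H] [Bialgebra K H]

/-- The isomorphism class of a module. -/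
def mk (M : FDMod K H) : IsoClass K H := Quotient.mk _ M

/-- Isomorphism classes form a monoid under the tensor product. -/
instance : Monoid (IsoClass K H) where
  mul := Quotient.map₂ FDMod.tensor fun _ _ ⟨e⟩ _ _ ⟨f⟩ => FDMod.tensor_congr e f
  one := mk (FDMod.trivial K H)
  mul_assoc := by
    rintro ⟨L⟩ ⟨M⟩ ⟨N⟩
    exact Quotient.sound (FDMod.tensor_assoc L M N)
  one_mul := by
    rintro ⟨M⟩
    exact Quotient.sound (FDMod.trivial_tensor M)
  mul_one := by
    rintro ⟨M⟩
    exact Quotient.sound (FDMod.tensor_trivial M)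

theorem mk_surjective : Function.Surjective (mk (K := K) (H := H)) := Quotient.mk_surjective

theorem mk_mul_mk (M N : FDMod K H) : mk M * mk N = mk (M.tensor N) := rfl

end IsoClass

section GreenRing

variable (K H : Type u) [Field K] [Ring H] [Bialgebra K H]

/-- The elements `[M ⊕ N] - [M] - [N]` of the free abelian group on isomorphism classes. -/
def greenRelations : Set (FreeAbelianGroup (IsoClass K H)) :=
  {r | ∃ M N : FDMod K H, r = FreeAbelianGroup.of (IsoClass.mk (M.directSum N)) -
    FreeAbelianGroup.of (IsoClass.mk M) - FreeAbelianGroup.of (IsoClass.mk N)}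

variable {K H}

theorem mul_mem_closure_greenRelations (a r : FreeAbelianGroup (IsoClass K H))
    (hr : r ∈ AddSubgroup.closure (greenRelations K H)) :
    a * r ∈ AddSubgroup.closure (greenRelations K H) := by
  induction hr using AddSubgroup.closure_induction with
  | zero => simp
  | add x y _ _ hx hy => rw [mul_add]; exact add_mem hx hy
  | neg x _ hx => rw [mul_neg]; exact neg_mem hx
  | mem x hx =>
    obtain ⟨M, N, rfl⟩ := hx
    induction a using FreeAbelianGroup.induction_on with
    | zero => simp
    | neg x hx => rw [neg_mul]; exact neg_mem hx
    | add x y hx hy => rw [add_mul]; exact add_mem hx hy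
    | of x =>
      obtain ⟨L, rfl⟩ := IsoClass.mk_surjective x
      refine AddSubgroup.subset_closure ⟨L.tensor M, L.tensor N, ?_⟩
      rw [mul_sub, mul_sub]
      simp only [FreeAbelianGroup.of_mul_of, IsoClass.mk_mul_mk]
      congr 3
      exact Quotient.sound (FDMod.tensor_directSum L M N)

theorem mul_mem_closure_greenRelations' (a r : FreeAbelianGroup (IsoClass K H))
    (hr : r ∈ AddSubgroup.closure (greenRelations K H)) :
    r * a ∈ AddSubgroup.closure (greenRelations K H) := by
  induction hr using AddSubgroup.closure_induction with
  | zero => simp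
  | add x y _ _ hx hy => rw [add_mul]; exact add_mem hx hy
  | neg x _ hx => rw [neg_mul]; exact neg_mem hx
  | mem x hx =>
    obtain ⟨M, N, rfl⟩ := hx
    induction a using FreeAbelianGroup.induction_on with
    | zero => simp
    | neg x hx => rw [mul_neg]; exact neg_mem hx
    | add x y hx hy => rw [mul_add]; exact add_mem hx hy
    | of x =>
      obtain ⟨L, rfl⟩ := IsoClass.mk_surjective x
      refine AddSubgroup.subset_closure ⟨M.tensor L, N.tensor L, ?_⟩
      rw [sub_mul, sub_mul]
      simp only [FreeAbelianGroup.of_mul_of, IsoClass.mk_mul_mk]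
      congr 3
      exact Quotient.sound (FDMod.directSum_tensor M N L)

variable (K H)

/-- The subgroup generated by all `[M ⊕ N] - [M] - [N]`; it is a two-sided ideal for the
multiplication `[M] [N] = [M ⊗ N]`. -/
def greenIdeal : Ideal (FreeAbelianGroup (IsoClass K H)) where
  carrier := AddSubgroup.closure (greenRelations K H)
  add_mem' := add_mem
  zero_mem' := zero_mem _
  smul_mem' a r hr := mul_mem_closure_greenRelations a r hr

instance : (greenIdeal K H).IsTwoSided :=
  ⟨fun b hr => mul_mem_closure_greenRelations' b _ hr⟩

/-- The Green ring `r(H)`: the abelian group generated by the isomorphism classes of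
finite-dimensional modules modulo `[M ⊕ N] = [M] + [N]`, with `[M] [N] = [M ⊗ N]`. -/
abbrev GreenRing : Type (u + 1) := FreeAbelianGroup (IsoClass K H) ⧸ greenIdeal K H

variable {K H}

/-- The class `[M]` in the Green ring. -/
def greenClass (M : FDMod K H) : GreenRing K H :=
  Ideal.Quotient.mk (greenIdeal K H) (FreeAbelianGroup.of (IsoClass.mk M))

theorem greenClass_mul (M N : FDMod K H) :
    greenClass M * greenClass N = greenClass (M.tensor N) := by
  rw [greenClass, greenClass, ← map_mul, FreeAbelianGroup.of_mul_of]; rfl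

theorem greenClass_add (M N : FDMod K H) :
    greenClass (M.directSum N) = greenClass M + greenClass N := by
  rw [← sub_eq_zero, ← sub_sub, greenClass, greenClass, greenClass, ← map_sub, ← map_sub,
    Ideal.Quotient.eq_zero_iff_mem]
  exact AddSubgroup.subset_closure ⟨M, N, rfl⟩

variable (K H)

/-- The projective class ring `r_p(H)`: the subring of the Green ring generated by the classes of
projective modules and of simple modules. -/
def projectiveClassRing : Subring (GreenRing K H) :=
  Subring.closure {r | ∃ M : FDMod K H,
    (Module.Projective H M ∨ IsSimpleModule H M) ∧ r = greenClass M}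

end GreenRing

/-- `π : P → M` is a projective cover: `P` is projective, `π` is surjective, and the kernel of `π`
is superfluous. -/
structure IsProjectiveCover {R P M : Type*} [Ring R] [AddCommGroup P] [Module R P]
    [AddCommGroup M] [Module R M] (π : P →ₗ[R] M) : Prop where
  projective : Module.Projective R P
  surjective : Function.Surjective π
  superfluous : ∀ N : Submodule R P, N ⊔ LinearMap.ker π = ⊤ → N = ⊤

/-! ### Taft algebras -/

/-- If `b a = q a b` and `q` is a primitive `n`-th root of unity, then
`(a + b)^n = a^n + b^n`. -/
theorem add_pow_of_qCommute {K A : Type*} [Field K] [Ring A] [Algebra K A] {q : K} {n : ℕ}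
    (hn : n ≠ 0) (hq : IsPrimitiveRoot q n) {a b : A} (hab : b * a = q • (a * b)) :
    (a + b) ^ n = a ^ n + b ^ n := by
  classical
  -- Gaussian binomial coefficients
  obtain ⟨c, c0, cs0, cs⟩ : ∃ c : ℕ → ℕ → K, (∀ k, c 0 k = if k = 0 then 1 else 0) ∧
      (∀ m, c (m + 1) 0 = c m 0) ∧
      ∀ m k, c (m + 1) (k + 1) = c m k + q ^ (k + 1) * c m (k + 1) :=
    ⟨fun m => Nat.rec (fun k => if k = 0 then 1 else 0)
      (fun _ f k => Nat.casesOn k (f 0) fun j => f j + q ^ (j + 1) * f (j + 1)) m,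
      fun _ => rfl, fun _ => rfl, fun _ _ => rfl⟩
  have cm0 : ∀ m, c m 0 = 1 := by
    intro m; induction m with
    | zero => simp [c0]
    | succ m ih => rw [cs0, ih]
  have cgt : ∀ m k, m < k → c m k = 0 := by
    intro m; induction m with
    | zero => intro k hk; simp [c0, hk.ne']
    | succ m ih =>
      intro k hk
      obtain ⟨k, rfl⟩ : ∃ j, k = j + 1 := ⟨k - 1, by omega⟩
      rw [cs, ih k (by omega), ih (k + 1) (by omega)]; simp
  have cmm : ∀ m, c m m = 1 := by
    intro m; induction m with
    | zero => simp [c0]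
    | succ m ih => rw [cs, ih, cgt m (m + 1) (by omega)]; simp
  -- `(1 - q^(k+1)) [m+1, k+1] = (1 - q^(m+1)) [m, k]`
  have cmul : ∀ m k, (1 - q ^ (k + 1)) * c (m + 1) (k + 1) = (1 - q ^ (m + 1)) * c m k := by
    intro m; induction m with
    | zero =>
      intro k
      rw [cs]
      cases k with
      | zero => simp [c0]
      | succ k => simp [c0]
    | succ m ih =>
      intro k
      have h1 := ih k
      cases k with
      | zero =>
        rw [cs, cm0]
        rw [cm0] at h1
        linear_combination q ^ (0 + 1) * h1
      | succ k =>
        have h2 := ih k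
        have h3 := cs m k
        rw [cs (m + 1) (k + 1)]
        linear_combination q ^ (k + 2) * h1 + q * h2 - q * (1 - q ^ (m + 1)) * h3
  have bpow : ∀ k, b * a ^ k = q ^ k • (a ^ k * b) := by
    intro k; induction k with
    | zero => simp
    | succ k ih =>
      rw [pow_succ, ← mul_assoc, ih, smul_mul_assoc, mul_assoc, hab, mul_smul_comm, smul_smul,
        ← pow_succ, ← mul_assoc]
  have expand : ∀ m, (a + b) ^ m = ∑ k ∈ Finset.range (m + 1), c m k • (a ^ k * b ^ (m - k)) := by
    intro m; induction m with
    | zero => simp [c0]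
    | succ m ih =>
      rw [pow_succ', ih, add_mul, Finset.mul_sum, Finset.mul_sum]
      rw [Finset.sum_range_succ' _ (m + 1)]
      have e1 : ∀ k ∈ Finset.range (m + 1), a * (c m k • (a ^ k * b ^ (m - k))) =
          c m k • (a ^ (k + 1) * b ^ (m - k)) := by
        intro k _; rw [mul_smul_comm, ← mul_assoc, ← pow_succ']
      have e2 : ∀ k ∈ Finset.range (m + 1), b * (c m k • (a ^ k * b ^ (m - k))) =
          (q ^ k * c m k) • (a ^ k * b ^ (m + 1 - k)) := by
        intro k hk
        have : m + 1 - k = (m - k) + 1 := by have := Finset.mem_range.mp hk; omega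
        rw [this, mul_smul_comm, ← mul_assoc, bpow, smul_mul_assoc, mul_assoc, ← pow_succ',
          smul_smul, mul_comm]
      rw [Finset.sum_congr rfl e1, Finset.sum_congr rfl e2]
      have e3 : ∀ k ∈ Finset.range (m + 1),
          c (m + 1) (k + 1) • (a ^ (k + 1) * b ^ (m + 1 - (k + 1))) =
          c m k • (a ^ (k + 1) * b ^ (m - k)) +
            (q ^ (k + 1) * c m (k + 1)) • (a ^ (k + 1) * b ^ (m + 1 - (k + 1))) := by
        intro k _; rw [cs, add_smul, Nat.add_sub_add_right]
      rw [Finset.sum_congr rfl e3, Finset.sum_add_distrib, add_assoc]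
      congr 1
      rw [Finset.sum_range_succ' _ m, Finset.sum_range_succ _ m, cgt m (m + 1) (by omega)]
      simp [cs0]
  rw [expand, Finset.sum_range_succ, Nat.sub_self, pow_zero, mul_one, cmm, one_smul]
  obtain ⟨n, rfl⟩ : ∃ j, n = j + 1 := ⟨n - 1, by omega⟩
  rw [Finset.sum_range_succ', cm0, pow_zero, one_mul, one_smul, Nat.sub_zero,
    Finset.sum_eq_zero, zero_add, add_comm]
  intro k hk
  have hk := Finset.mem_range.mp hk
  have h := cmul n k
  rw [hq.pow_eq_one, sub_self, zero_mul] at h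
  rcases mul_eq_zero.mp h with h | h
  · exact absurd (sub_eq_zero.mp h).symm (hq.pow_ne_one_of_pos_of_lt (by omega) (by omega))
  · rw [h, zero_smul]

/-- If `x u = c u x` and `x^m = 0` then `(x u)^m = 0`. -/
theorem mul_pow_eq_zero_of_qCommute {K A : Type*} [Field K] [Ring A] [Algebra K A] {c : K} {m : ℕ}
    {x u : A} (h : u * x = c • (x * u)) (hx : x ^ m = 0) : (x * u) ^ m = 0 := by
  have h1 : ∀ k, u ^ k * x = c ^ k • (x * u ^ k) := by
    intro k; induction k with
    | zero => simp
    | succ k ih =>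
      rw [pow_succ, mul_assoc, h, mul_smul_comm, ← mul_assoc, ih, smul_mul_assoc, smul_smul,
        ← pow_succ', mul_assoc, ← pow_succ]
  have h2 : ∀ k, ∃ d : K, (x * u) ^ k = d • (x ^ k * u ^ k) := by
    intro k; induction k with
    | zero => exact ⟨1, by simp⟩
    | succ k ih =>
      obtain ⟨d, hd⟩ := ih
      refine ⟨d * c ^ k, ?_⟩
      rw [pow_succ, hd, smul_mul_assoc, mul_assoc, ← mul_assoc (u ^ k), h1, smul_mul_assoc,
        mul_smul_comm, smul_smul, mul_assoc, ← mul_assoc (x ^ k), ← pow_succ, ← pow_succ]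
  obtain ⟨d, hd⟩ := h2 m
  rw [hd, hx, zero_mul, smul_zero]

/-- The generators of a Taft algebra. -/
inductive TaftGen : Type
  | g
  | x

/-- The relations `g^n = 1`, `x^n = 0`, `x g = q g x`. -/
inductive TaftRel (K : Type u) [Field K] (n : ℕ) (q : K) :
    FreeAlgebra K TaftGen → FreeAlgebra K TaftGen → Prop
  | g_pow : TaftRel K n q (FreeAlgebra.ι K TaftGen.g ^ n) 1
  | x_pow : TaftRel K n q (FreeAlgebra.ι K TaftGen.x ^ n) 0
  | x_mul_g : TaftRel K n q (FreeAlgebra.ι K TaftGen.x * FreeAlgebra.ι K TaftGen.g)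
      (q • (FreeAlgebra.ι K TaftGen.g * FreeAlgebra.ι K TaftGen.x))

/-- The Taft algebra `A_n(q)`, generated by `g` and `x` with relations
`g^n = 1`, `x^n = 0`, `x g = q g x`. -/
def Taft (K : Type u) [Field K] (n : ℕ) (q : K) : Type u := RingQuot (TaftRel K n q)

namespace Taft

variable {K : Type u} [Field K] {n : ℕ} {q : K}

instance : Ring (Taft K n q) := inferInstanceAs (Ring (RingQuot (TaftRel K n q)))

instance : Algebra K (Taft K n q) := inferInstanceAs (Algebra K (RingQuot (TaftRel K n q)))

variable (K n q) in
/-- The quotient map from the free algebra. -/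
def mkHom : FreeAlgebra K TaftGen →ₐ[K] Taft K n q := RingQuot.mkAlgHom K (TaftRel K n q)

variable (K n q) in
/-- The generator `g`. -/
def g : Taft K n q := mkHom K n q (FreeAlgebra.ι K TaftGen.g)

variable (K n q) in
/-- The generator `x`. -/
def x : Taft K n q := mkHom K n q (FreeAlgebra.ι K TaftGen.x)

theorem g_pow : g K n q ^ n = 1 := by
  have := RingQuot.mkAlgHom_rel K (TaftRel.g_pow (K := K) (n := n) (q := q))
  rwa [map_pow, map_one] at this

theorem x_pow : x K n q ^ n = 0 := by
  have := RingQuot.mkAlgHom_rel K (TaftRel.x_pow (K := K) (n := n) (q := q))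
  rwa [map_pow, map_zero] at this

theorem x_mul_g : x K n q * g K n q = q • (g K n q * x K n q) := by
  have := RingQuot.mkAlgHom_rel K (TaftRel.x_mul_g (K := K) (n := n) (q := q))
  rwa [map_mul, map_smul, map_mul] at this

/-- The universal property of the Taft algebra. -/
def lift {B : Type*} [Ring B] [Algebra K B] (G X : B) (hG : G ^ n = 1) (hX : X ^ n = 0)
    (hXG : X * G = q • (G * X)) : Taft K n q →ₐ[K] B :=
  RingQuot.liftAlgHom K ⟨FreeAlgebra.lift K fun t => TaftGen.casesOn t G X, by
    intro a b h
    cases h <;> simp [hG, hX, hXG]⟩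

section lift

variable {B : Type*} [Ring B] [Algebra K B] (G X : B) (hG : G ^ n = 1) (hX : X ^ n = 0)
    (hXG : X * G = q • (G * X))

@[simp]
theorem lift_g : lift G X hG hX hXG (g K n q) = G := by
  refine (RingQuot.liftAlgHom_mkAlgHom_apply K _ _ _).trans ?_
  simp

@[simp]
theorem lift_x : lift G X hG hX hXG (x K n q) = X := by
  refine (RingQuot.liftAlgHom_mkAlgHom_apply K _ _ _).trans ?_
  simp

end lift

theorem algHom_ext {B : Type*} [Semiring B] [Algebra K B] {φ ψ : Taft K n q →ₐ[K] B}
    (hg : φ (g K n q) = ψ (g K n q)) (hx : φ (x K n q) = ψ (x K n q)) : φ = ψ := by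
  refine RingQuot.ringQuot_ext' (s := TaftRel K n q) K φ ψ ?_
  refine FreeAlgebra.hom_ext (funext fun t => ?_)
  cases t
  · exact hg
  · exact hx

theorem induction {P : Taft K n q → Prop} (hr : ∀ r : K, P (algebraMap K _ r))
    (hg : P (g K n q)) (hx : P (x K n q)) (hadd : ∀ a b, P a → P b → P (a + b))
    (hmul : ∀ a b, P a → P b → P (a * b)) (t : Taft K n q) : P t := by
  obtain ⟨f, rfl⟩ := RingQuot.mkAlgHom_surjective K (TaftRel K n q) t
  change P (mkHom K n q f)
  induction f using FreeAlgebra.induction with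
  | grade0 r => rw [AlgHom.commutes]; exact hr r
  | grade1 t => cases t; exacts [hg, hx]
  | mul a b ha hb => rw [map_mul]; exact hmul _ _ ha hb
  | add a b ha hb => rw [map_add]; exact hadd _ _ ha hb

variable (K n q) in
/-- The counit: `ε(g) = 1`, `ε(x) = 0`. -/
def counitHom [NeZero n] : Taft K n q →ₐ[K] K :=
  lift 1 0 (one_pow n) (zero_pow (NeZero.ne n)) (by simp)

variable (K n q) in
/-- The comultiplication: `Δ(g) = g ⊗ g`, `Δ(x) = x ⊗ g + 1 ⊗ x`. -/
def comulHom [NeZero n] [hq : Fact (IsPrimitiveRoot q n)] :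
    Taft K n q →ₐ[K] Taft K n q ⊗[K] Taft K n q :=
  lift (g K n q ⊗ₜ g K n q) (x K n q ⊗ₜ g K n q + 1 ⊗ₜ x K n q)
    (by rw [Algebra.TensorProduct.tmul_pow, g_pow, Algebra.TensorProduct.one_def])
    (by
      rw [add_pow_of_qCommute (NeZero.ne n) hq.out, Algebra.TensorProduct.tmul_pow,
        Algebra.TensorProduct.tmul_pow, x_pow, TensorProduct.zero_tmul, TensorProduct.tmul_zero,
        add_zero]
      rw [Algebra.TensorProduct.tmul_mul_tmul, Algebra.TensorProduct.tmul_mul_tmul, x_mul_g,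
        one_mul, mul_one, TensorProduct.tmul_smul])
    (by
      simp only [add_mul, mul_add, Algebra.TensorProduct.tmul_mul_tmul, x_mul_g, one_mul, mul_one,
        TensorProduct.tmul_smul, TensorProduct.smul_tmul', smul_add])

instance [NeZero n] [Fact (IsPrimitiveRoot q n)] : Bialgebra K (Taft K n q) :=
  Bialgebra.ofAlgHom (comulHom K n q) (counitHom K n q)
    (by
      apply algHom_ext
      · simp [comulHom]
      · simp [comulHom, TensorProduct.add_tmul, TensorProduct.tmul_add,
          Algebra.TensorProduct.one_def, add_assoc])
    (by apply algHom_ext <;> simp [comulHom, counitHom])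
    (by apply algHom_ext <;> simp [comulHom, counitHom])

theorem pred_pow_mul [NeZero n] : g K n q ^ (n - 1) * g K n q = 1 := by
  rw [← pow_succ, Nat.sub_add_cancel (NeZero.one_le), g_pow]

theorem mul_pred_pow [NeZero n] : g K n q * g K n q ^ (n - 1) = 1 := by
  rw [← pow_succ', Nat.sub_add_cancel (NeZero.one_le), g_pow]

theorem pred_pow_mul_x [NeZero n] :
    g K n q ^ (n - 1) * x K n q = q • (x K n q * g K n q ^ (n - 1)) := by
  calc g K n q ^ (n - 1) * x K n q
      = g K n q ^ (n - 1) * (x K n q * g K n q) * g K n q ^ (n - 1) := by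
        rw [mul_assoc, mul_assoc, mul_pred_pow, mul_one]
    _ = q • (x K n q * g K n q ^ (n - 1)) := by
        rw [x_mul_g, mul_smul_comm, ← mul_assoc, pred_pow_mul, one_mul, smul_mul_assoc]

variable (K n q) in
/-- The antipode, an algebra anti-homomorphism: `S(g) = g^(n-1)`, `S(x) = - x g^(n-1)`. -/
def antipodeHom [NeZero n] : Taft K n q →ₐ[K] (Taft K n q)ᵐᵒᵖ :=
  lift (MulOpposite.op (g K n q ^ (n - 1))) (MulOpposite.op (-(x K n q * g K n q ^ (n - 1))))
    (by rw [← MulOpposite.op_pow, ← pow_mul, mul_comm, pow_mul, g_pow, one_pow,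
      MulOpposite.op_one])
    (by rw [← MulOpposite.op_pow, neg_pow, mul_pow_eq_zero_of_qCommute pred_pow_mul_x x_pow,
      mul_zero, MulOpposite.op_zero])
    (by
      rw [← MulOpposite.op_mul, ← MulOpposite.op_mul, ← MulOpposite.op_smul, mul_neg, neg_mul,
        ← mul_assoc, pred_pow_mul_x, smul_mul_assoc, smul_neg])

variable (K n q) in
/-- The antipode as a linear map. -/
def antipodeLin [NeZero n] : Taft K n q →ₗ[K] Taft K n q :=
  (MulOpposite.opLinearEquiv K).symm.toLinearMap ∘ₗ (antipodeHom K n q).toLinearMap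

section antipode

variable [NeZero n]

@[simp]
theorem antipodeLin_g : antipodeLin K n q (g K n q) = g K n q ^ (n - 1) := by
  simp [antipodeLin, antipodeHom]

@[simp]
theorem antipodeLin_x : antipodeLin K n q (x K n q) = -(x K n q * g K n q ^ (n - 1)) := by
  simp [antipodeLin, antipodeHom]

@[simp]
theorem antipodeLin_one : antipodeLin K n q 1 = 1 := by
  simp [antipodeLin]

theorem antipodeLin_mul (a b : Taft K n q) :
    antipodeLin K n q (a * b) = antipodeLin K n q b * antipodeLin K n q a := by
  simp [antipodeLin]

variable [Fact (IsPrimitiveRoot q n)]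

@[simp]
theorem comul_g : Coalgebra.comul (R := K) (g K n q) = g K n q ⊗ₜ g K n q :=
  lift_g _ _ _ _ _

@[simp]
theorem comul_x : Coalgebra.comul (R := K) (x K n q) = x K n q ⊗ₜ g K n q + 1 ⊗ₜ x K n q :=
  lift_x _ _ _ _ _

@[simp]
theorem counit_g : Coalgebra.counit (R := K) (g K n q) = 1 :=
  lift_g _ _ _ _ _

@[simp]
theorem counit_x : Coalgebra.counit (R := K) (x K n q) = 0 :=
  lift_x _ _ _ _ _

theorem mul_antipode_rTensor (t : Taft K n q) :
    LinearMap.mul' K _ ((antipodeLin K n q).rTensor _ (Coalgebra.comul (R := K) t)) =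
      algebraMap K _ (Coalgebra.counit (R := K) t) := by
  have key : ∀ (s : Taft K n q ⊗[K] Taft K n q) (a b : Taft K n q),
      LinearMap.mul' K _ ((antipodeLin K n q).rTensor _ (s * a ⊗ₜ b)) = antipodeLin K n q a *
        LinearMap.mul' K _ ((antipodeLin K n q).rTensor _ s) * b := by
    intro s a b
    induction s with
    | zero => simp
    | add s t hs ht => simp only [add_mul, mul_add, map_add, hs, ht]
    | tmul c d => simp [antipodeLin_mul, mul_assoc]
  induction t using induction with
  | hr r => simp [Algebra.TensorProduct.one_def, Algebra.algebraMap_eq_smul_one]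
  | hg => simp [pred_pow_mul]
  | hx => simp [mul_assoc, pred_pow_mul]
  | hadd a b ha hb => simp only [map_add, ha, hb]
  | hmul a b ha hb =>
    rw [Bialgebra.comul_mul, Bialgebra.counit_mul, map_mul (algebraMap K _), ← hb]
    generalize (Coalgebra.comul b : Taft K n q ⊗[K] Taft K n q) = s
    induction s with
    | zero => simp
    | add s t hs ht => simp only [mul_add, map_add, hs, ht]
    | tmul c d =>
      rw [key, ha, ← Algebra.commutes, mul_assoc]
      simp

theorem mul_antipode_lTensor (t : Taft K n q) :
    LinearMap.mul' K _ ((antipodeLin K n q).lTensor _ (Coalgebra.comul (R := K) t)) =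
      algebraMap K _ (Coalgebra.counit (R := K) t) := by
  have key : ∀ (s : Taft K n q ⊗[K] Taft K n q) (a b : Taft K n q),
      LinearMap.mul' K _ ((antipodeLin K n q).lTensor _ (a ⊗ₜ b * s)) =
        a * LinearMap.mul' K _ ((antipodeLin K n q).lTensor _ s) * antipodeLin K n q b := by
    intro s a b
    induction s with
    | zero => simp
    | add s t hs ht => simp only [add_mul, mul_add, map_add, hs, ht]
    | tmul c d => simp [antipodeLin_mul, mul_assoc]
  induction t using induction with
  | hr r => simp [Algebra.TensorProduct.one_def, Algebra.algebraMap_eq_smul_one]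
  | hg => simp [mul_pred_pow]
  | hx => simp
  | hadd a b ha hb => simp only [map_add, ha, hb]
  | hmul a b ha hb =>
    rw [Bialgebra.comul_mul, Bialgebra.counit_mul, mul_comm, map_mul (algebraMap K _), ← ha]
    generalize (Coalgebra.comul a : Taft K n q ⊗[K] Taft K n q) = s
    induction s with
    | zero => simp
    | add s t hs ht => simp only [add_mul, mul_add, map_add, hs, ht]
    | tmul c d =>
      rw [key, hb, ← Algebra.commutes, mul_assoc]
      simp

instance : HopfAlgebra K (Taft K n q) where
  antipode := antipodeLin K n q
  mul_antipode_rTensor_comul := LinearMap.ext mul_antipode_rTensor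
  mul_antipode_lTensor_comul := LinearMap.ext mul_antipode_lTensor

end antipode

instance [h : Fact (IsPrimitiveRoot q n)] : Fact (IsPrimitiveRoot q⁻¹ n) := ⟨h.out.inv⟩

/-- The character `g ↦ ζ`, `x ↦ 0` of the Taft algebra, for an `n`-th root of unity `ζ`. -/
def character [NeZero n] (ζ : K) (hζ : ζ ^ n = 1) : Taft K n q →ₐ[K] K :=
  lift ζ 0 hζ (zero_pow (NeZero.ne n)) (by simp)

end Taft

/-! ### The tensor product of two Taft algebras -/

section TaftTensor

variable (K : Type u) [Field K] (n : ℕ) (q : K)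

/-- The Hopf algebra `H_n(q) = A_n(q) ⊗ A_n(q⁻¹)`. -/
abbrev TaftTensor : Type u := Taft K n q ⊗[K] Taft K n q⁻¹

namespace TaftTensor

/-- `a = 1 ⊗ x₁`. -/
def a : TaftTensor K n q := 1 ⊗ₜ Taft.x K n q⁻¹

/-- `b = 1 ⊗ g₁`. -/
def b : TaftTensor K n q := 1 ⊗ₜ Taft.g K n q⁻¹

/-- `c = g ⊗ 1`. -/
def c : TaftTensor K n q := Taft.g K n q ⊗ₜ 1

/-- `d = x ⊗ 1`. -/
def d : TaftTensor K n q := Taft.x K n q ⊗ₜ 1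

variable [NeZero n] [hq : Fact (IsPrimitiveRoot q n)]

/-- The character `b ↦ q^i`, `c ↦ q^j`, `a, d ↦ 0`. -/
def character (i j : ℕ) : TaftTensor K n q →ₐ[K] K :=
  Algebra.TensorProduct.lift
    (Taft.character (q ^ j) (by rw [← pow_mul, mul_comm, pow_mul, hq.out.pow_eq_one, one_pow]))
    (Taft.character (q ^ i) (by rw [← pow_mul, mul_comm, pow_mul, hq.out.pow_eq_one, one_pow]))
    (fun _ _ => Commute.all _ _)

/-- The one-dimensional module `S_{i,j}`, on which `b` acts by `q^i`, `c` acts by `q^j` and `a`, `d`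
act by zero. It depends only on the residues of `i` and `j` modulo `n`. -/
def S (i j : ℕ) : FDMod K (TaftTensor K n q) := FDMod.ofCharacter (character K n q i j)

theorem b_smul (i j : ℕ) (v : S K n q i j) : b K n q • v = q ^ i • v := by
  change character K n q i j (b K n q) • v = q ^ i • v
  simp [character, b, Taft.character]

theorem c_smul (i j : ℕ) (v : S K n q i j) : c K n q • v = q ^ j • v := by
  change character K n q i j (c K n q) • v = q ^ j • v
  simp [character, c, Taft.character]

theorem a_smul (i j : ℕ) (v : S K n q i j) : a K n q • v = 0 := by
  change character K n q i j (a K n q) • v = 0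
  simp [character, a, Taft.character]

theorem d_smul (i j : ℕ) (v : S K n q i j) : d K n q • v = 0 := by
  change character K n q i j (d K n q) • v = 0
  simp [character, d, Taft.character]

end TaftTensor

end TaftTensor

/-- The ideal `(x^n - 1, y^n - 1, z^2 - ∑_{0 ≤ i, j ≤ n - 1} x^i y^j z)` of `ℤ[x, y, z]`, where
`x`, `y`, `z` are the variables `X 0`, `X 1`, `X 2`. -/
def presentationIdeal (n : ℕ) : Ideal (MvPolynomial (Fin 3) ℤ) :=
  Ideal.span {MvPolynomial.X 0 ^ n - 1, MvPolynomial.X 1 ^ n - 1,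
    MvPolynomial.X 2 ^ 2 - ∑ i ∈ Finset.range n, ∑ j ∈ Finset.range n,
      MvPolynomial.X 0 ^ i * MvPolynomial.X 1 ^ j * MvPolynomial.X 2}

end

/-!
Let `P i j` be the module induced from the character `b ↦ q ^ i`, `c ↦ q ^ j` of the group generated
by `b` and `c`. Homomorphisms from `P i j` to a module `M` are the vectors of weight
`(q ^ i, q ^ j)` in `M`, and such vectors lift along surjections because the group algebra is
semisimple; hence `P i j` is projective, and it is the projective cover of `S i j`. Since `a` and
`d` are nilpotent, every nonzero module contains a nonzero weight vector killed by both, so every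
simple module is some `S i j` and every projective module is a direct sum of modules `P i j`.

If `V` has a basis of weight vectors, then `V ⊗ P i j` is generated by the tensor products of these
with the generator of `P i j`, so by counting dimensions it is the direct sum of the `P k l` over
the shifted weights. This gives `[S i j] = x ^ i y ^ j`, `[P i j] = x ^ i y ^ j z` and the relation
for `z ^ 2`, with `x = [S 1 0]`, `y = [S 0 1]` and `z = [P 0 0]`. The relations reduce every element
of the presented ring to a combination of these `2 n ^ 2` monomials. They are linearly independent
in the Green ring: the rank of a fixed element of the algebra acting on `M` is additive in `M`, and
the idempotent `e` of weight `(q ^ i, q ^ j)` and its multiple `d ^ (n - 1) a ^ (n - 1) e` separate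
the classes.
-/

noncomputable section

section GreenRing

variable {K H : Type u} [Field K] [Ring H] [Bialgebra K H]

theorem greenClass_congr {M N : FDMod K H} (e : M ≃ₗ[H] N) : greenClass M = greenClass N :=
  congrArg (fun c => Ideal.Quotient.mk (greenIdeal K H) (FreeAbelianGroup.of c))
    (Quotient.sound ⟨e⟩)

theorem greenClass_trivial : greenClass (FDMod.trivial K H) = 1 := rfl

theorem greenClass_of_subsingleton (M : FDMod K H) [Subsingleton M] : greenClass M = 0 := by
  have h : greenClass (M.directSum M) = greenClass M :=
    let _ : Unique M := uniqueOfSubsingleton 0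
    greenClass_congr (M := M.directSum M) (LinearEquiv.prodUnique (M₂ := M))
  rwa [greenClass_add, add_eq_left] at h

section Lift

variable {A : Type*} [AddCommGroup A] (f : FDMod K H → A)
  (hiso : ∀ M N : FDMod K H, (M ≃ₗ[H] N) → f M = f N)
  (hadd : ∀ M N : FDMod K H, f (M.directSum N) = f M + f N)

/-- The function on isomorphism classes induced by an isomorphism invariant of modules. -/
def IsoClass.lift : IsoClass K H → A :=
  Quotient.lift (s := FDMod.isoSetoid K H) f fun M N ⟨e⟩ => hiso M N e

/-- The homomorphism on the Green ring induced by an additive isomorphism invariant of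
finite-dimensional modules. -/
def greenLift : GreenRing K H →+ A :=
  QuotientAddGroup.lift (greenIdeal K H).toAddSubgroup
    (FreeAbelianGroup.lift (IsoClass.lift f hiso)) (by
      change AddSubgroup.closure (greenRelations K H) ≤ _
      rw [AddSubgroup.closure_le]
      rintro _ ⟨M, N, rfl⟩
      rw [SetLike.mem_coe, AddMonoidHom.mem_ker, map_sub, map_sub, sub_sub, sub_eq_zero]
      simp only [FreeAbelianGroup.lift_apply_of]
      exact hadd M N)

theorem greenLift_greenClass (M : FDMod K H) : greenLift f hiso hadd (greenClass M) = f M :=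
  FreeAbelianGroup.lift_apply_of _ _

end Lift

theorem finrank_range_prodMap {V V' W W' : Type*} [AddCommGroup V] [Module K V]
    [AddCommGroup V'] [Module K V'] [AddCommGroup W] [Module K W] [AddCommGroup W'] [Module K W']
    [Module.Finite K W] [Module.Finite K W'] (f : V →ₗ[K] W) (g : V' →ₗ[K] W') :
    Module.finrank K (LinearMap.range (f.prodMap g)) =
      Module.finrank K (LinearMap.range f) + Module.finrank K (LinearMap.range g) := by
  have h : LinearMap.range (f.prodMap g) =
      LinearMap.range ((LinearMap.range f).subtype.prodMap (LinearMap.range g).subtype) :=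
    SetLike.coe_injective (by simp [LinearMap.range_prodMap])
  rw [h, LinearMap.finrank_range_of_inj, Module.finrank_prod]
  exact Prod.map_injective.mpr ⟨Subtype.val_injective, Subtype.val_injective⟩

theorem finrank_range_rep_congr {M N : FDMod K H} (e : M ≃ₗ[H] N) (h : H) :
    Module.finrank K (LinearMap.range (M.rep h)) =
      Module.finrank K (LinearMap.range (N.rep h)) := by
  have he : N.rep h = (e.restrictScalars K).toLinearMap ∘ₗ M.rep h ∘ₗ
      (e.restrictScalars K).symm.toLinearMap :=
    LinearMap.ext fun m => by simp [FDMod.rep]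
  rw [he, LinearMap.range_comp, LinearEquiv.range_comp, LinearEquiv.finrank_map_eq]

/-- The additive function on the Green ring sending `[M]` to the rank of `h` acting on `M`. -/
def greenRank (h : H) : GreenRing K H →+ ℤ :=
  greenLift (fun M => (Module.finrank K (LinearMap.range (M.rep h)) : ℤ))
    (fun _ _ e => congrArg Nat.cast (finrank_range_rep_congr e h))
    (fun M N => by
      rw [← Nat.cast_add, ← finrank_range_prodMap]
      rfl)

theorem greenRank_greenClass (h : H) (M : FDMod K H) :
    greenRank h (greenClass M) = Module.finrank K (LinearMap.range (M.rep h)) :=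
  greenLift_greenClass _ _ _ M

theorem greenRank_eq_zero {h : H} {M : FDMod K H} (hM : ∀ m : M, h • m = 0) :
    greenRank h (greenClass M) = 0 := by
  have hzero : M.rep h = 0 := LinearMap.ext hM
  rw [greenRank_greenClass, hzero, LinearMap.range_zero, finrank_bot, Nat.cast_zero]

namespace FDMod

/-- The direct sum of a finite family of modules. -/
def pi {ι : Type} [Finite ι] (N : ι → FDMod K H) : FDMod K H where
  carrier := ∀ i, N i

/-- A submodule of a finite-dimensional module, as a finite-dimensional module. -/
def ofSubmodule {M : FDMod K H} (N : Submodule H M) : FDMod K H where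
  carrier := N
  finite := inferInstanceAs (Module.Finite K (N.restrictScalars K))

/-- A quotient of a finite-dimensional module, as a finite-dimensional module. -/
def ofQuotient {M : FDMod K H} (N : Submodule H M) : FDMod K H where
  carrier := M ⧸ N
  finite := Module.Finite.of_surjective (N.mkQ.restrictScalars K) N.mkQ_surjective

end FDMod

theorem greenClass_pi {ι : Type} [Fintype ι] (N : ι → FDMod K H) :
    greenClass (FDMod.pi N) = ∑ i, greenClass (N i) := by
  revert N
  refine Fintype.induction_empty_option (P := fun ι _ => ∀ N : ι → FDMod K H,
    greenClass (FDMod.pi N) = ∑ i, greenClass (N i)) ?equiv ?empty ?option ι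
  case equiv =>
    intro α β _ e ih N
    let _ : Fintype α := Fintype.ofEquiv β e.symm
    rw [← e.sum_comp, ← ih fun i => N (e i)]
    exact (greenClass_congr (M := FDMod.pi fun i => N (e i)) (N := FDMod.pi N)
      (LinearEquiv.piCongrLeft H (fun i => (N i : Type u)) e)).symm
  case empty =>
    intro N
    have : Subsingleton (FDMod.pi N) := inferInstanceAs (Subsingleton (∀ i, N i))
    rw [Finset.univ_eq_empty, Finset.sum_empty, greenClass_of_subsingleton]
  case option =>
    intro α _ ih N
    rw [Fintype.sum_option, ← ih fun i => N (some i), ← greenClass_add]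
    exact greenClass_congr (M := FDMod.pi N)
      (N := (N none).directSum (FDMod.pi fun i => N (some i)))
      (LinearEquiv.piOptionEquivProd H (M := fun i => (N i : Type u)))

theorem nonempty_equiv_ker_prod_of_surjective {R M N : Type*} [Ring R] [AddCommGroup M]
    [Module R M] [AddCommGroup N] [Module R N] [Module.Projective R N] (f : M →ₗ[R] N)
    (hf : Function.Surjective f) : Nonempty (M ≃ₗ[R] LinearMap.ker f × N) := by
  obtain ⟨g, hg⟩ := Module.projective_lifting_property f LinearMap.id hf
  exact ⟨((LinearMap.exact_subtype_ker_map f).splitSurjectiveEquiv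
    Subtype.val_injective ⟨g, hg⟩).1⟩

theorem greenClass_eq_ker_add {M N : FDMod K H} [Module.Projective H N] (f : M →ₗ[H] N)
    (hf : Function.Surjective f) :
    greenClass M = greenClass (FDMod.ofSubmodule (LinearMap.ker f)) + greenClass N := by
  obtain ⟨e⟩ := nonempty_equiv_ker_prod_of_surjective f hf
  rw [← greenClass_add]
  exact greenClass_congr (N := (FDMod.ofSubmodule (LinearMap.ker f)).directSum N) e

theorem greenClass_eq_of_surjective {M N : FDMod K H} (f : M →ₗ[H] N)
    (hf : Function.Surjective f) (hd : Module.finrank K M = Module.finrank K N) :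
    greenClass M = greenClass N :=
  have hi : Function.Injective f :=
    (LinearMap.injective_iff_surjective_of_finrank_eq_finrank
      (f := f.restrictScalars K) hd).mpr hf
  greenClass_congr (LinearEquiv.ofBijective f ⟨hi, hf⟩)

theorem IsProjectiveCover.exists_surjective {R P Q M : Type*} [Ring R] [AddCommGroup P]
    [Module R P] [AddCommGroup Q] [Module R Q] [AddCommGroup M] [Module R M]
    [Module.Projective R Q] {π : P →ₗ[R] M} (hπ : IsProjectiveCover π) {τ : Q →ₗ[R] M}
    (hτ : Function.Surjective τ) : ∃ f : Q →ₗ[R] P, Function.Surjective f := by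
  obtain ⟨f, rfl⟩ := Module.projective_lifting_property π τ hπ.surjective
  have hsup : LinearMap.range f ⊔ LinearMap.ker π = ⊤ := by
    rw [← LinearMap.map_eq_top_iff (LinearMap.range_eq_top.mpr hπ.surjective),
      ← LinearMap.range_comp, LinearMap.range_eq_top]
    exact hτ
  exact ⟨f, LinearMap.range_eq_top.mp (hπ.superfluous _ hsup)⟩

theorem IsProjectiveCover.greenClass_eq {P Q : FDMod K H} {M : Type*} [AddCommGroup M]
    [Module H M] {π : P →ₗ[H] M} {τ : Q →ₗ[H] M} (hπ : IsProjectiveCover π)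
    (hτ : IsProjectiveCover τ) : greenClass P = greenClass Q := by
  have := hπ.projective
  have := hτ.projective
  obtain ⟨f, hf⟩ := hπ.exists_surjective hτ.surjective
  obtain ⟨g, hg⟩ := hτ.exists_surjective hπ.surjective
  exact greenClass_eq_of_surjective g hg (le_antisymm
    (LinearMap.finrank_le_finrank_of_surjective (f := f.restrictScalars K) hf)
    (LinearMap.finrank_le_finrank_of_surjective (f := g.restrictScalars K) hg))

end GreenRing

theorem map_smul_of_adjoin_eq_top {R A M N : Type*} [CommSemiring R] [Semiring A] [Algebra R A]
    [AddCommMonoid M] [Module R M] [Module A M] [IsScalarTower R A M]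
    [AddCommMonoid N] [Module R N] [Module A N] [IsScalarTower R A N] {s : Set A}
    (hs : Algebra.adjoin R s = ⊤) (f : M →ₗ[R] N) (hf : ∀ x ∈ s, ∀ m, f (x • m) = x • f m)
    (x : A) (m : M) : f (x • m) = x • f m := by
  have hx : x ∈ Algebra.adjoin R s := hs ▸ Algebra.mem_top
  induction hx using Algebra.adjoin_induction generalizing m with
  | mem x hx => exact hf x hx m
  | algebraMap r => rw [algebraMap_smul, algebraMap_smul, map_smul]
  | add x y _ _ hx hy => rw [add_smul, add_smul, map_add, hx, hy]
  | mul x y _ _ hx hy => rw [mul_smul, mul_smul, hx, hy]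

theorem adjoin_image_includeLeft_union_image_includeRight {R A B : Type*} [CommSemiring R]
    [Semiring A] [Algebra R A] [Semiring B] [Algebra R B] {s : Set A} {t : Set B}
    (hs : Algebra.adjoin R s = ⊤) (ht : Algebra.adjoin R t = ⊤) :
    Algebra.adjoin R ((Algebra.TensorProduct.includeLeft : A →ₐ[R] A ⊗[R] B) '' s ∪
      (Algebra.TensorProduct.includeRight : B →ₐ[R] A ⊗[R] B) '' t) = ⊤ := by
  rw [Algebra.adjoin_union, ← AlgHom.map_adjoin, ← AlgHom.map_adjoin, hs, ht]
  refine Algebra.eq_top_iff.mpr fun x => ?_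
  induction x using TensorProduct.induction_on with
  | zero => exact zero_mem _
  | add x y hx hy => exact add_mem hx hy
  | tmul x y =>
    rw [← mul_one x, ← one_mul y, ← Algebra.TensorProduct.tmul_mul_tmul]
    exact mul_mem (Algebra.mem_sup_left ⟨x, trivial, rfl⟩)
      (Algebra.mem_sup_right ⟨y, trivial, rfl⟩)

theorem Taft.adjoin_g_x (K : Type u) [Field K] (n : ℕ) (q : K) :
    Algebra.adjoin K {Taft.g K n q, Taft.x K n q} = ⊤ := by
  refine Algebra.eq_top_iff.mpr fun t => ?_
  induction t using Taft.induction with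
  | hr r => exact Subalgebra.algebraMap_mem _ r
  | hg => exact Algebra.subset_adjoin (Set.mem_insert _ _)
  | hx => exact Algebra.subset_adjoin (Set.mem_insert_of_mem _ rfl)
  | hadd s t hs ht => exact add_mem hs ht
  | hmul s t hs ht => exact mul_mem hs ht

namespace TaftTensor

section Generators

variable {K : Type u} [Field K] {n : ℕ} {q : K}

theorem a_pow : a K n q ^ n = 0 := by
  rw [a, Algebra.TensorProduct.tmul_pow, Taft.x_pow, TensorProduct.tmul_zero]

theorem d_pow : d K n q ^ n = 0 := by
  rw [d, Algebra.TensorProduct.tmul_pow, Taft.x_pow, TensorProduct.zero_tmul]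

theorem b_pow : b K n q ^ n = 1 := by
  rw [b, Algebra.TensorProduct.tmul_pow, Taft.g_pow, one_pow, Algebra.TensorProduct.one_def]

theorem c_pow : c K n q ^ n = 1 := by
  rw [c, Algebra.TensorProduct.tmul_pow, Taft.g_pow, one_pow, Algebra.TensorProduct.one_def]

theorem a_mul_b : a K n q * b K n q = q⁻¹ • (b K n q * a K n q) := by
  rw [a, b, Algebra.TensorProduct.tmul_mul_tmul, Algebra.TensorProduct.tmul_mul_tmul,
    Taft.x_mul_g, TensorProduct.tmul_smul]

theorem d_mul_c : d K n q * c K n q = q • (c K n q * d K n q) := by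
  rw [d, c, Algebra.TensorProduct.tmul_mul_tmul, Algebra.TensorProduct.tmul_mul_tmul,
    Taft.x_mul_g, TensorProduct.smul_tmul']

theorem commute_tmul_one_one_tmul (s : Taft K n q) (t : Taft K n q⁻¹) :
    Commute (s ⊗ₜ[K] (1 : Taft K n q⁻¹)) ((1 : Taft K n q) ⊗ₜ[K] t) := by
  rw [commute_iff_eq, Algebra.TensorProduct.tmul_mul_tmul, Algebra.TensorProduct.tmul_mul_tmul,
    one_mul, mul_one, one_mul, mul_one]

theorem commute_c_a : Commute (c K n q) (a K n q) := commute_tmul_one_one_tmul _ _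

theorem commute_c_b : Commute (c K n q) (b K n q) := commute_tmul_one_one_tmul _ _

theorem commute_d_a : Commute (d K n q) (a K n q) := commute_tmul_one_one_tmul _ _

theorem commute_d_b : Commute (d K n q) (b K n q) := commute_tmul_one_one_tmul _ _

theorem adjoin_generators :
    Algebra.adjoin K {a K n q, b K n q, c K n q, d K n q} = ⊤ := by
  refine top_le_iff.mp ?_
  rw [← adjoin_image_includeLeft_union_image_includeRight (Taft.adjoin_g_x K n q)
    (Taft.adjoin_g_x K n q⁻¹)]
  refine Algebra.adjoin_mono (Set.union_subset ?_ ?_)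
  · rintro _ ⟨_, rfl | rfl, rfl⟩ <;> simp [c, d]
  · rintro _ ⟨_, rfl | rfl, rfl⟩ <;> simp [a, b]

/-- The `H_n(q)`-linear map underlying a `K`-linear map that commutes with the generators. -/
def homOfGenerators {M N : Type*} [AddCommGroup M] [Module K M] [Module (TaftTensor K n q) M]
    [IsScalarTower K (TaftTensor K n q) M] [AddCommGroup N] [Module K N]
    [Module (TaftTensor K n q) N] [IsScalarTower K (TaftTensor K n q) N] (f : M →ₗ[K] N)
    (ha : ∀ m, f (a K n q • m) = a K n q • f m) (hb : ∀ m, f (b K n q • m) = b K n q • f m)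
    (hc : ∀ m, f (c K n q • m) = c K n q • f m) (hd : ∀ m, f (d K n q • m) = d K n q • f m) :
    M →ₗ[TaftTensor K n q] N :=
  { f with
    map_smul' := map_smul_of_adjoin_eq_top adjoin_generators f (by
      rintro _ (rfl | rfl | rfl | rfl) <;> assumption) }

end Generators

section Comultiplication

variable {K : Type u} [Field K] {n : ℕ} {q : K} [NeZero n] [Fact (IsPrimitiveRoot q n)]

theorem comul_a : Coalgebra.comul (R := K) (a K n q) =
    a K n q ⊗ₜ b K n q + 1 ⊗ₜ a K n q := by
  simp [a, b, TensorProduct.comul_tmul, Bialgebra.comul_one, Algebra.TensorProduct.one_def,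
    TensorProduct.tmul_add]

theorem comul_b : Coalgebra.comul (R := K) (b K n q) = b K n q ⊗ₜ b K n q := by
  simp [b, TensorProduct.comul_tmul, Bialgebra.comul_one, Algebra.TensorProduct.one_def]

theorem comul_c : Coalgebra.comul (R := K) (c K n q) = c K n q ⊗ₜ c K n q := by
  simp [c, TensorProduct.comul_tmul, Bialgebra.comul_one, Algebra.TensorProduct.one_def]

theorem comul_d : Coalgebra.comul (R := K) (d K n q) =
    d K n q ⊗ₜ c K n q + 1 ⊗ₜ d K n q := by
  simp [c, d, TensorProduct.comul_tmul, Bialgebra.comul_one, Algebra.TensorProduct.one_def,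
    TensorProduct.add_tmul]

end Comultiplication

end TaftTensor

namespace FDMod

variable {K H : Type u} [Field K] [Ring H] [Bialgebra K H] {M N : FDMod K H}

/-- The pure tensor `m ⊗ w`, as a bilinear map with values in the module `M ⊗ N`. -/
def tmul : M →ₗ[K] N →ₗ[K] M.tensor N := TensorProduct.mk K M N

theorem smul_tmul_eq_tensorAction (h : H) (m : M) (w : N) :
    h • tmul m w = tensorAction M.rep N.rep (Coalgebra.comul h) (m ⊗ₜ[K] w) := rfl

theorem smul_tmul_of_comul_eq_tmul {g : H} (hg : Coalgebra.comul (R := K) g = g ⊗ₜ g)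
    (m : M) (w : N) : g • tmul m w = tmul (g • m) (g • w) := by
  rw [smul_tmul_eq_tensorAction, hg, tensorAction_tmul_tmul]
  rfl

theorem smul_tmul_of_comul_eq_add {x g : H} (hx : Coalgebra.comul (R := K) x = x ⊗ₜ g + 1 ⊗ₜ x)
    (m : M) (w : N) : x • tmul m w = tmul (x • m) (g • w) + tmul m (x • w) := by
  rw [smul_tmul_eq_tensorAction, hx, map_add, LinearMap.add_apply, tensorAction_tmul_tmul,
    tensorAction_tmul_tmul, map_one]
  rfl

theorem finrank_tensor (M N : FDMod K H) :
    Module.finrank K (M.tensor N) = Module.finrank K M * Module.finrank K N :=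
  Module.finrank_tensorProduct

end FDMod

namespace TaftTensor

variable {K : Type u} [Field K] {n : ℕ} {q : K} [NeZero n] [Fact (IsPrimitiveRoot q n)]
  {M N : FDMod K (TaftTensor K n q)} (m : M) (w : N)

theorem a_smul_tmul : a K n q • FDMod.tmul m w =
    FDMod.tmul (a K n q • m) (b K n q • w) + FDMod.tmul m (a K n q • w) :=
  FDMod.smul_tmul_of_comul_eq_add comul_a m w

theorem b_smul_tmul :
    b K n q • FDMod.tmul m w = FDMod.tmul (b K n q • m) (b K n q • w) :=
  FDMod.smul_tmul_of_comul_eq_tmul comul_b m w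

theorem c_smul_tmul :
    c K n q • FDMod.tmul m w = FDMod.tmul (c K n q • m) (c K n q • w) :=
  FDMod.smul_tmul_of_comul_eq_tmul comul_c m w

theorem d_smul_tmul : d K n q • FDMod.tmul m w =
    FDMod.tmul (d K n q • m) (c K n q • w) + FDMod.tmul m (d K n q • w) :=
  FDMod.smul_tmul_of_comul_eq_add comul_d m w

end TaftTensor

theorem pow_pow_eq_one {M : Type*} [Monoid M] {q : M} {n : ℕ} (hq : q ^ n = 1) (i : ℕ) :
    (q ^ i) ^ n = 1 := by
  rw [pow_right_comm, hq, one_pow]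

theorem exists_smul_eq_zero_and_ne_zero {R V : Type*} [Monoid R] [AddMonoid V]
    [DistribMulAction R V] {r : R} {k : ℕ} {m : V} (hm : m ≠ 0) (hk : r ^ k • m = 0) :
    ∃ l, r ^ l • m ≠ 0 ∧ r • r ^ l • m = 0 := by
  classical
  have hex : ∃ l, r ^ (l + 1) • m = 0 := ⟨k, by rw [pow_succ', mul_smul, hk, smul_zero]⟩
  refine ⟨Nat.find hex, ?_, by rw [smul_smul, ← pow_succ']; exact Nat.find_spec hex⟩
  cases h : Nat.find hex with
  | zero => simpa using hm
  | succ l => exact Nat.find_min hex (h ▸ l.lt_succ_self)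

section EigenProjector

variable {K A : Type*} [Field K] [Ring A] [Algebra K A] {n : ℕ} {t : A}

/-- For `t ^ n = 1` and an `n`-th root of unity `z` in a field in which `n` is invertible, the
idempotent projecting onto the `z`-eigenspace of `t`. -/
def eigenProjector (n : ℕ) (t : A) (z : K) : A :=
  (n : K)⁻¹ • ∑ i ∈ Finset.range n, (z⁻¹ • t) ^ i

theorem mul_eigenProjector [NeZero n] (ht : t ^ n = 1) {z : K} (hz : z ^ n = 1) :
    t * eigenProjector n t z = z • eigenProjector n t z := by
  have hz₀ : z ≠ 0 := (IsUnit.of_pow_eq_one hz (NeZero.ne n)).ne_zero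
  have h : z⁻¹ • t * ∑ i ∈ Finset.range n, (z⁻¹ • t) ^ i =
      ∑ i ∈ Finset.range n, (z⁻¹ • t) ^ i := by
    rw [← sub_eq_zero, ← sub_one_mul, mul_geom_sum, smul_pow, inv_pow, hz, ht, inv_one, one_smul,
      sub_self]
  rw [smul_mul_assoc, inv_smul_eq_iff₀ hz₀] at h
  rw [eigenProjector, mul_smul_comm, h, smul_comm]

theorem commute_eigenProjector {s : A} (h : Commute s t) (n : ℕ) (z : K) :
    Commute s (eigenProjector n t z) :=
  (Commute.sum_right _ _ _ fun i _ => (h.smul_right z⁻¹).pow_right i).smul_right _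

theorem pow_smul_of_smul_eq_smul {M : Type*} [AddCommGroup M] [Module K M] [Module A M]
    [IsScalarTower K A M] {w : K} {m : M} (hm : t • m = w • m) (i : ℕ) :
    t ^ i • m = w ^ i • m := by
  induction i with
  | zero => rw [pow_zero, pow_zero, one_smul, one_smul]
  | succ i ih => rw [pow_succ, mul_smul, hm, smul_algebra_smul_comm, ih, smul_smul, pow_succ']

theorem geom_sum_of_pow_eq_one [DecidableEq K] {x : K} (hx : x ^ n = 1) :
    ∑ i ∈ Finset.range n, x ^ i = if x = 1 then (n : K) else 0 := by
  split_ifs with h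
  · simp [h]
  · rw [geom_sum_eq h, hx, sub_self, zero_div]

theorem eigenProjector_smul {M : Type*} [AddCommGroup M] [Module K M] [Module A M]
    [IsScalarTower K A M] [DecidableEq K] (hn : (n : K) ≠ 0) {z w : K} (hz : z ^ n = 1)
    (hw : w ^ n = 1) {m : M} (hm : t • m = w • m) :
    eigenProjector n t z • m = if w = z then m else 0 := by
  have hz₀ : z ≠ 0 := (IsUnit.of_pow_eq_one hz (by rintro rfl; simp at hn)).ne_zero
  have hpow (i : ℕ) : (z⁻¹ • t) ^ i • m = (z⁻¹ * w) ^ i • m :=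
    pow_smul_of_smul_eq_smul (by rw [smul_assoc, hm, smul_smul]) i
  have hzw : (z⁻¹ * w) ^ n = 1 := by rw [mul_pow, inv_pow, hz, hw, inv_one, one_mul]
  rw [eigenProjector, smul_assoc, Finset.sum_smul, Finset.sum_congr rfl fun i _ => hpow i,
    ← Finset.sum_smul, geom_sum_of_pow_eq_one hzw]
  simp only [inv_mul_eq_one₀ hz₀, eq_comm (a := z), ite_smul, zero_smul, smul_ite, smul_zero,
    inv_smul_smul₀ hn]

theorem sum_eigenProjector [NeZero n] {q : K} (hq : IsPrimitiveRoot q n) (t : A) :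
    ∑ i ∈ Finset.range n, eigenProjector n t (q ^ i) = 1 := by
  classical
  have hn : (n : K) ≠ 0 := hq.neZero'.ne
  have hcoeff (j : ℕ) (hj : j ∈ Finset.range n) :
      ∑ i ∈ Finset.range n, ((q ^ i)⁻¹ • t) ^ j = if j = 0 then (n : K) • (1 : A) else 0 := by
    have hroot : (q⁻¹ ^ j) ^ n = 1 := pow_pow_eq_one hq.inv.pow_eq_one j
    have hone : q⁻¹ ^ j = 1 ↔ j = 0 :=
      ⟨fun h => Nat.eq_zero_of_dvd_of_lt (hq.inv.dvd_of_pow_eq_one j h) (Finset.mem_range.mp hj),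
        by rintro rfl; exact pow_zero _⟩
    simp only [smul_pow, ← inv_pow, pow_right_comm _ _ j]
    rw [← Finset.sum_smul, geom_sum_of_pow_eq_one hroot]
    split_ifs <;> simp_all
  simp only [eigenProjector]
  rw [← Finset.smul_sum, Finset.sum_comm, Finset.sum_congr rfl hcoeff, Finset.sum_ite_eq',
    if_pos (Finset.mem_range.mpr (NeZero.pos n)), smul_smul, inv_mul_cancel₀ hn, one_smul]

end EigenProjector

namespace TaftTensor

section Weights

variable {K : Type u} [Field K] {n : ℕ} {q : K} {M N : Type*} [AddCommGroup M] [Module K M]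
  [Module (TaftTensor K n q) M] [IsScalarTower K (TaftTensor K n q) M] [AddCommGroup N]
  [Module K N] [Module (TaftTensor K n q) N] [IsScalarTower K (TaftTensor K n q) N]

variable (n q) in
/-- `m` is a weight vector of weight `(β, γ)`: a simultaneous eigenvector (or zero) of the
grouplike elements `b` and `c`, with eigenvalues `β` and `γ`. -/
structure IsWeightVector (β γ : K) (m : M) : Prop where
  b_smul : b K n q • m = β • m
  c_smul : c K n q • m = γ • m

namespace IsWeightVector

variable {β γ : K} {m : M}

theorem smul (hm : IsWeightVector n q β γ m) (r : K) : IsWeightVector n q β γ (r • m) where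
  b_smul := by rw [smul_algebra_smul_comm, hm.b_smul, smul_comm]
  c_smul := by rw [smul_algebra_smul_comm, hm.c_smul, smul_comm]

theorem a_smul (hq : q ≠ 0) (hm : IsWeightVector n q β γ m) :
    IsWeightVector n q (q * β) γ (a K n q • m) where
  b_smul := by
    have hba : b K n q * a K n q = q • (a K n q * b K n q) := by rw [a_mul_b, smul_inv_smul₀ hq]
    rw [smul_smul, hba, smul_assoc, mul_smul (a K n q), hm.b_smul, smul_algebra_smul_comm,
      smul_smul]
  c_smul := by rw [smul_smul, commute_c_a.eq, mul_smul, hm.c_smul, smul_algebra_smul_comm]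

theorem d_smul (hq : q ≠ 0) (hm : IsWeightVector n q β γ m) :
    IsWeightVector n q β (q⁻¹ * γ) (d K n q • m) where
  b_smul := by rw [smul_smul, ← commute_d_b.eq, mul_smul, hm.b_smul, smul_algebra_smul_comm]
  c_smul := by
    have hcd : c K n q * d K n q = q⁻¹ • (d K n q * c K n q) := by
      rw [d_mul_c, inv_smul_smul₀ hq]
    rw [smul_smul, hcd, smul_assoc, mul_smul (d K n q), hm.c_smul, smul_algebra_smul_comm,
      smul_smul]

theorem a_pow_smul (hq : q ≠ 0) (hm : IsWeightVector n q β γ m) (t : ℕ) :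
    IsWeightVector n q (q ^ t * β) γ (a K n q ^ t • m) := by
  induction t with
  | zero => simpa using hm
  | succ t ih => simpa only [pow_succ', mul_smul, mul_assoc] using ih.a_smul hq

theorem d_pow_smul (hq : q ≠ 0) (hm : IsWeightVector n q β γ m) (s : ℕ) :
    IsWeightVector n q β (q⁻¹ ^ s * γ) (d K n q ^ s • m) := by
  induction s with
  | zero => simpa using hm
  | succ s ih => simpa only [pow_succ', mul_smul, mul_assoc] using ih.d_smul hq

end IsWeightVector

variable (n q) in
/-- The idempotent of `H_n(q)` projecting onto the vectors of weight `(β, γ)`. -/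
def weightProjector (β γ : K) : TaftTensor K n q :=
  eigenProjector n (b K n q) β * eigenProjector n (c K n q) γ

variable [NeZero n]

theorem isWeightVector_weightProjector_smul {β γ : K} (hβ : β ^ n = 1) (hγ : γ ^ n = 1) (m : M) :
    IsWeightVector n q β γ (weightProjector n q β γ • m) where
  b_smul := by
    rw [smul_smul, weightProjector, ← mul_assoc, mul_eigenProjector b_pow hβ, smul_mul_assoc,
      smul_assoc]
  c_smul := by
    rw [smul_smul, weightProjector, ← mul_assoc, (commute_eigenProjector commute_c_b n β).eq,
      mul_assoc, mul_eigenProjector c_pow hγ, mul_smul_comm, smul_assoc]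

theorem weightProjector_smul [DecidableEq K] (hq : IsPrimitiveRoot q n) {β γ β' γ' : K}
    (hβ : β ^ n = 1) (hγ : γ ^ n = 1) (hβ' : β' ^ n = 1) (hγ' : γ' ^ n = 1) {m : M}
    (hm : IsWeightVector n q β' γ' m) :
    weightProjector n q β γ • m = if β' = β ∧ γ' = γ then m else 0 := by
  have hn : (n : K) ≠ 0 := hq.neZero'.ne
  rw [weightProjector, mul_smul, eigenProjector_smul hn hγ hγ' hm.c_smul, smul_ite, smul_zero,
    eigenProjector_smul hn hβ hβ' hm.b_smul, ← ite_and]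
  simp only [and_comm]

theorem sum_weightProjector (hq : IsPrimitiveRoot q n) :
    ∑ i ∈ Finset.range n, ∑ j ∈ Finset.range n, weightProjector n q (q ^ i) (q ^ j) = 1 := by
  simp only [weightProjector, ← Finset.mul_sum, ← Finset.sum_mul, sum_eigenProjector hq, one_mul]

theorem exists_isWeightVector_ne_zero (hq : IsPrimitiveRoot q n) [Nontrivial M] :
    ∃ i < n, ∃ j < n, ∃ m : M, IsWeightVector n q (q ^ i) (q ^ j) m ∧ m ≠ 0 := by
  obtain ⟨m, hm⟩ := exists_ne (0 : M)
  rw [← one_smul (TaftTensor K n q) m, ← sum_weightProjector hq, Finset.sum_smul] at hm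
  obtain ⟨i, hi_mem, hi⟩ := Finset.exists_ne_zero_of_sum_ne_zero hm
  rw [Finset.sum_smul] at hi
  obtain ⟨j, hj_mem, hj⟩ := Finset.exists_ne_zero_of_sum_ne_zero hi
  exact ⟨i, Finset.mem_range.mp hi_mem, j, Finset.mem_range.mp hj_mem, _,
    isWeightVector_weightProjector_smul (pow_pow_eq_one hq.pow_eq_one i)
      (pow_pow_eq_one hq.pow_eq_one j) m, hj⟩

theorem IsWeightVector.exists_lift (hq : IsPrimitiveRoot q n) {β γ : K} (hβ : β ^ n = 1)
    (hγ : γ ^ n = 1) {f : M →ₗ[TaftTensor K n q] N} (hf : Function.Surjective f) {v : N}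
    (hv : IsWeightVector n q β γ v) : ∃ m, IsWeightVector n q β γ m ∧ f m = v := by
  classical
  obtain ⟨m, rfl⟩ := hf v
  refine ⟨weightProjector n q β γ • m, isWeightVector_weightProjector_smul hβ hγ m, ?_⟩
  rw [map_smul, weightProjector_smul hq hβ hγ hβ hγ hv, if_pos ⟨rfl, rfl⟩]

theorem exists_isWeightVector_smul_eq_zero (hq : IsPrimitiveRoot q n) [Nontrivial M] :
    ∃ i < n, ∃ j < n, ∃ m : M, IsWeightVector n q (q ^ i) (q ^ j) m ∧ m ≠ 0 ∧
      a K n q • m = 0 ∧ d K n q • m = 0 := by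
  obtain ⟨i₀, -, j₀, -, m, hm, hm₀⟩ := exists_isWeightVector_ne_zero (M := M) hq
  obtain ⟨k, hk₀, hk⟩ := exists_smul_eq_zero_and_ne_zero (r := a K n q) (k := n) hm₀
    (by rw [a_pow, zero_smul])
  obtain ⟨l, hl₀, hl⟩ := exists_smul_eq_zero_and_ne_zero (r := d K n q) (k := n) hk₀
    (by rw [d_pow, zero_smul])
  have hw := (hm.a_pow_smul (hq.ne_zero (NeZero.ne n)) k).d_pow_smul
    (hq.ne_zero (NeZero.ne n)) l
  obtain ⟨i, hi, hβ⟩ := hq.eq_pow_of_pow_eq_one (ξ := q ^ k * q ^ i₀) (by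
    rw [mul_pow, pow_pow_eq_one hq.pow_eq_one, pow_pow_eq_one hq.pow_eq_one, one_mul])
  obtain ⟨j, hj, hγ⟩ := hq.eq_pow_of_pow_eq_one (ξ := q⁻¹ ^ l * q ^ j₀) (by
    rw [mul_pow, pow_pow_eq_one hq.inv.pow_eq_one, pow_pow_eq_one hq.pow_eq_one, one_mul])
  rw [← hβ, ← hγ] at hw
  refine ⟨i, hi, j, hj, _, hw, hl₀, ?_, hl⟩
  rw [smul_smul, ← (commute_d_a.pow_left l).eq, mul_smul, hk, smul_zero]

end Weights

end TaftTensor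

theorem isSimpleModule_of_finrank_eq_one {K H M : Type*} [Field K] [Ring H] [Algebra K H]
    [AddCommGroup M] [Module K M] [Module H M] [IsScalarTower K H M] (hM : Module.finrank K M = 1) :
    IsSimpleModule H M :=
  { toIsSimpleOrder := is_simple_module_of_finrank_eq_one hM }

namespace TaftTensor

section Simple

variable {K : Type u} [Field K] {n : ℕ} {q : K} [NeZero n] [Fact (IsPrimitiveRoot q n)]

variable (q) in
/-- The basis vector of `S_{i,j}`. -/
def unitS (i j : ℕ) : S K n q i j := (1 : K)

variable {i j : ℕ}

theorem unitS_ne_zero : unitS (n := n) q i j ≠ 0 := one_ne_zero (α := K)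

theorem finrank_S : Module.finrank K (S K n q i j) = 1 := Module.finrank_self K

theorem isWeightVector_S (v : S K n q i j) : IsWeightVector n q (q ^ i) (q ^ j) v :=
  ⟨b_smul K n q i j v, c_smul K n q i j v⟩

instance isSimpleModule_S : IsSimpleModule (TaftTensor K n q) (S K n q i j) :=
  isSimpleModule_of_finrank_eq_one finrank_S

theorem nonempty_equiv_S {M : FDMod K (TaftTensor K n q)} [IsSimpleModule (TaftTensor K n q) M]
    {m : M} (hm₀ : m ≠ 0) (hm : IsWeightVector n q (q ^ i) (q ^ j) m) (ha : a K n q • m = 0)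
    (hd : d K n q • m = 0) : Nonempty (S K n q i j ≃ₗ[TaftTensor K n q] M) := by
  let f : S K n q i j →ₗ[K] M := LinearMap.toSpanSingleton K M m
  have hf (v : S K n q i j) : ∃ r : K, f v = r • m := ⟨v, rfl⟩
  let F : S K n q i j →ₗ[TaftTensor K n q] M := homOfGenerators f
    (fun v => by
      obtain ⟨r, hr⟩ := hf v
      rw [a_smul, map_zero, hr, smul_algebra_smul_comm, ha, smul_zero])
    (fun v => by
      obtain ⟨r, hr⟩ := hf v
      rw [b_smul, map_smul, hr, (hm.smul r).b_smul])
    (fun v => by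
      obtain ⟨r, hr⟩ := hf v
      rw [c_smul, map_smul, hr, (hm.smul r).c_smul])
    (fun v => by
      obtain ⟨r, hr⟩ := hf v
      rw [d_smul, map_zero, hr, smul_algebra_smul_comm, hd, smul_zero])
  have hF : F (unitS q i j) = m := LinearMap.toSpanSingleton_apply_one K M m
  have hF₀ : F ≠ 0 := by
    rintro h
    exact hm₀ (by rw [← hF, h, LinearMap.zero_apply])
  exact ⟨LinearEquiv.ofBijective F (LinearMap.bijective_of_ne_zero hF₀)⟩

theorem exists_equiv_S (M : FDMod K (TaftTensor K n q)) [IsSimpleModule (TaftTensor K n q) M] :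
    ∃ i < n, ∃ j < n, Nonempty (S K n q i j ≃ₗ[TaftTensor K n q] M) := by
  have := IsSimpleModule.nontrivial (TaftTensor K n q) M
  obtain ⟨i, hi, j, hj, m, hm, hm₀, ha, hd⟩ :=
    exists_isWeightVector_smul_eq_zero (M := M) (Fact.out : IsPrimitiveRoot q n)
  exact ⟨i, hi, j, hj, nonempty_equiv_S hm₀ hm ha hd⟩

theorem greenClass_eq_S {M : FDMod K (TaftTensor K n q)} (hM : Module.finrank K M = 1) {m : M}
    (hm₀ : m ≠ 0) (hm : IsWeightVector n q (q ^ i) (q ^ j) m) (ha : a K n q • m = 0)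
    (hd : d K n q • m = 0) : greenClass M = greenClass (S K n q i j) := by
  have : IsSimpleModule (TaftTensor K n q) M := isSimpleModule_of_finrank_eq_one hM
  obtain ⟨e⟩ := nonempty_equiv_S hm₀ hm ha hd
  exact (greenClass_congr e).symm

theorem greenClass_S_eq_one (hi : q ^ i = 1) (hj : q ^ j = 1) :
    greenClass (S K n q i j) = 1 := by
  have hχ : character K n q i j = Bialgebra.counitAlgHom K (TaftTensor K n q) := by
    refine Algebra.TensorProduct.ext ?_ ?_ <;> apply Taft.algHom_ext <;>
      simp [character, Taft.character, hi, hj]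
  rw [S, hχ]
  exact greenClass_trivial

theorem greenClass_S_mul_S (i j k l : ℕ) : greenClass (S K n q i j) * greenClass (S K n q k l) =
    greenClass (S K n q (i + k) (j + l)) := by
  rw [greenClass_mul]
  refine greenClass_eq_S (m := FDMod.tmul (unitS q i j) (unitS q k l)) ?_ ?_ ⟨?_, ?_⟩ ?_ ?_
  · rw [FDMod.finrank_tensor, finrank_S, finrank_S]
  · change (1 : K) ⊗ₜ[K] (1 : K) ≠ 0
    exact fun h => one_ne_zero (α := K) (by simpa using congrArg (TensorProduct.lid K K) h)
  · rw [b_smul_tmul, b_smul, b_smul, LinearMap.map_smul₂, map_smul, smul_smul, pow_add]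
  · rw [c_smul_tmul, c_smul, c_smul, LinearMap.map_smul₂, map_smul, smul_smul, pow_add]
  · rw [a_smul_tmul, a_smul, a_smul, LinearMap.map_zero₂, map_zero, add_zero]
  · rw [d_smul_tmul, d_smul, d_smul, LinearMap.map_zero₂, map_zero, add_zero]

theorem greenClass_S (i j : ℕ) : greenClass (S K n q i j) =
    greenClass (S K n q 1 0) ^ i * greenClass (S K n q 0 1) ^ j := by
  induction i with
  | zero =>
    rw [pow_zero, one_mul]
    induction j with
    | zero => rw [pow_zero, greenClass_S_eq_one (pow_zero q) (pow_zero q)]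
    | succ j ih => rw [pow_succ, ← ih, greenClass_S_mul_S]
  | succ i ih => rw [pow_succ', mul_assoc, ← ih, greenClass_S_mul_S, zero_add, add_comm i]

end Simple

end TaftTensor

namespace Taft

/-- The algebra `K[x]/(x ^ n)`, the underlying space of the induced modules of the Taft algebra. -/
abbrev TruncatedPolynomial (K : Type u) [Field K] (n : ℕ) : Type u :=
  AdjoinRoot (Polynomial.X ^ n : Polynomial K)

section CyclicModule

variable {K : Type u} [Field K] {n : ℕ}

variable (K n) in
/-- The class of the variable in `K[x]/(x ^ n)`. -/
def root : TruncatedPolynomial K n := AdjoinRoot.root (Polynomial.X ^ n : Polynomial K)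

theorem root_pow : root K n ^ n = 0 := by
  have h := AdjoinRoot.mk_self (f := (Polynomial.X ^ n : Polynomial K))
  rwa [map_pow, AdjoinRoot.mk_X] at h

theorem root_pow_of_le {s : ℕ} (hs : n ≤ s) : root K n ^ s = 0 := pow_eq_zero_of_le hs root_pow

variable (K n) in
/-- The monomial basis of `K[x]/(x ^ n)`. -/
def rootBasis : Module.Basis (Fin n) K (TruncatedPolynomial K n) :=
  (AdjoinRoot.powerBasis' (Polynomial.monic_X_pow n)).basis.reindex
    (finCongr ((AdjoinRoot.powerBasis'_dim _).trans (Polynomial.natDegree_X_pow n)))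

theorem rootBasis_apply (s : Fin n) : rootBasis K n s = root K n ^ (s : ℕ) :=
  (Module.Basis.reindex_apply _ _ _).trans (PowerBasis.basis_eq_pow _ _)

instance : Module.Finite K (TruncatedPolynomial K n) := .of_basis (rootBasis K n)

variable (n) in
/-- The substitution `f(x) ↦ f(r x)` on `K[x]/(x ^ n)`. -/
def rescale (r : K) : TruncatedPolynomial K n →ₐ[K] TruncatedPolynomial K n :=
  AdjoinRoot.liftAlgHom (Polynomial.X ^ n : Polynomial K) (Algebra.ofId K _) (r • root K n) (by
    simp [smul_pow, root_pow])

theorem rescale_root (r : K) : rescale n r (root K n) = r • root K n :=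
  AdjoinRoot.liftAlgHom_root _ _ _ _

theorem rescale_root_pow (r : K) (s : ℕ) : rescale n r (root K n ^ s) = r ^ s • root K n ^ s := by
  rw [map_pow, rescale_root, smul_pow]

/-- The representation of `A_n(q)` on `K[x]/(x ^ n)` induced from the character `g ↦ z` of the
subalgebra generated by `g`: here `x` acts by multiplication and `g x ^ s = z q⁻ˢ x ^ s`. -/
def cyclicRep [NeZero n] {q : K} (hq : q ^ n = 1) {z : K} (hz : z ^ n = 1) :
    Taft K n q →ₐ[K] Module.End K (TruncatedPolynomial K n) :=
  lift (z • (rescale n q⁻¹).toLinearMap) (LinearMap.mulLeft K (root K n))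
    ((rootBasis K n).ext fun s => by
      have hs : (z • (rescale n q⁻¹).toLinearMap) • root K n ^ (s : ℕ) =
          (z * q⁻¹ ^ (s : ℕ)) • root K n ^ (s : ℕ) := by
        rw [mul_smul, ← rescale_root_pow]
        rfl
      rw [rootBasis_apply]
      refine (pow_smul_of_smul_eq_smul (K := K) (A := Module.End K _) hs n).trans ?_
      rw [mul_pow, hz, pow_right_comm, inv_pow, hq, inv_one, one_pow, one_mul, one_smul,
        Module.End.one_apply])
    (by rw [LinearMap.pow_mulLeft, root_pow, LinearMap.mulLeft_zero_eq_zero])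
    (LinearMap.ext fun f => by
      have hq₀ : q ≠ 0 := (IsUnit.of_pow_eq_one hq (NeZero.ne n)).ne_zero
      simp [rescale_root, smul_smul, mul_comm _ z, hq₀])

variable [NeZero n] {q : K} (hq : q ^ n = 1) {z : K} (hz : z ^ n = 1) (s : ℕ)

theorem cyclicRep_x_root_pow : cyclicRep hq hz (x K n q) (root K n ^ s) = root K n ^ (s + 1) := by
  rw [cyclicRep, lift_x, LinearMap.mulLeft_apply, pow_succ']

theorem cyclicRep_g_one : cyclicRep hq hz (g K n q) 1 = z • 1 := by
  rw [cyclicRep, lift_g, LinearMap.smul_apply, AlgHom.toLinearMap_apply, map_one]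

end CyclicModule

end Taft

namespace TaftTensor

section Projective

variable {K : Type u} [Field K] {n : ℕ} {q : K} [NeZero n] [hq : Fact (IsPrimitiveRoot q n)]

variable (n q) in
/-- The projective cover of `S_{i,j}`: the module induced from the one-dimensional module of weight
`(q ^ i, q ^ j)` over the subalgebra generated by `b` and `c`. -/
def P (i j : ℕ) : FDMod K (TaftTensor K n q) :=
  FDMod.ofRep ((Module.endTensorEndAlgHom (R := K) (S := K) (A := K)).comp
    (Algebra.TensorProduct.map
      (Taft.cyclicRep hq.out.pow_eq_one (pow_pow_eq_one hq.out.pow_eq_one j))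
      (Taft.cyclicRep hq.out.inv.pow_eq_one (pow_pow_eq_one hq.out.pow_eq_one i))))

variable (n q) in
/-- The vector `d ^ s a ^ t v` of `P i j`, where `v` is the generator; it is zero unless
`s, t < n`. -/
def vec (i j s t : ℕ) : P n q i j := (Taft.root K n ^ s) ⊗ₜ[K] (Taft.root K n ^ t)

variable (n q) in
/-- The basis `d ^ s a ^ t v` of `P i j`. -/
def basisP (i j : ℕ) : Module.Basis (Fin n × Fin n) K (P n q i j) :=
  (Taft.rootBasis K n).tensorProduct (Taft.rootBasis K n)

variable {i j : ℕ}

theorem basisP_apply (x : Fin n × Fin n) : basisP n q i j x = vec n q i j x.1 x.2 := by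
  rw [vec, ← Taft.rootBasis_apply, ← Taft.rootBasis_apply]
  exact Module.Basis.tensorProduct_apply' _ _ x

theorem finrank_P : Module.finrank K (P n q i j) = n * n := by
  rw [Module.finrank_eq_card_basis (basisP n q i j), Fintype.card_prod, Fintype.card_fin]

theorem vec_of_le_left {s t : ℕ} (h : n ≤ s) : vec n q i j s t = 0 := by
  rw [vec, Taft.root_pow_of_le h]
  exact TensorProduct.zero_tmul _ _

theorem vec_of_le_right {s t : ℕ} (h : n ≤ t) : vec n q i j s t = 0 := by
  rw [vec, Taft.root_pow_of_le h]
  exact TensorProduct.tmul_zero _ _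

theorem tmul_smul_vec (x : Taft K n q) (y : Taft K n q⁻¹) (s t : ℕ) :
    (x ⊗ₜ[K] y : TaftTensor K n q) • vec n q i j s t =
      (Taft.cyclicRep hq.out.pow_eq_one (pow_pow_eq_one hq.out.pow_eq_one j) x
        (Taft.root K n ^ s) ⊗ₜ[K]
      Taft.cyclicRep hq.out.inv.pow_eq_one (pow_pow_eq_one hq.out.pow_eq_one i) y
        (Taft.root K n ^ t) : Taft.TruncatedPolynomial K n ⊗[K] Taft.TruncatedPolynomial K n) :=
  rfl

theorem a_smul_vec (s t : ℕ) : a K n q • vec n q i j s t = vec n q i j s (t + 1) := by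
  rw [a, tmul_smul_vec, map_one, Module.End.one_apply, Taft.cyclicRep_x_root_pow, vec]

theorem d_smul_vec (s t : ℕ) : d K n q • vec n q i j s t = vec n q i j (s + 1) t := by
  rw [d, tmul_smul_vec, map_one, Module.End.one_apply, Taft.cyclicRep_x_root_pow, vec]

theorem isWeightVector_vec_zero : IsWeightVector n q (q ^ i) (q ^ j) (vec n q i j 0 0) where
  b_smul := by
    rw [b, tmul_smul_vec, map_one, Module.End.one_apply, pow_zero, Taft.cyclicRep_g_one,
      TensorProduct.tmul_smul, vec, pow_zero]
    rfl
  c_smul := by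
    rw [c, tmul_smul_vec, map_one, Module.End.one_apply, pow_zero, Taft.cyclicRep_g_one,
      ← TensorProduct.smul_tmul', vec, pow_zero]
    rfl

theorem a_pow_smul_vec (k s t : ℕ) : a K n q ^ k • vec n q i j s t = vec n q i j s (t + k) := by
  induction k with
  | zero => rw [pow_zero, one_smul, add_zero]
  | succ k ih => rw [pow_succ', mul_smul, ih, a_smul_vec, add_assoc]

theorem d_pow_smul_vec (k s t : ℕ) : d K n q ^ k • vec n q i j s t = vec n q i j (s + k) t := by
  induction k with
  | zero => rw [pow_zero, one_smul, add_zero]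
  | succ k ih => rw [pow_succ', mul_smul, ih, d_smul_vec, add_assoc]

theorem vec_eq_smul_vec_zero (s t : ℕ) :
    vec n q i j s t = d K n q ^ s • a K n q ^ t • vec n q i j 0 0 := by
  rw [a_pow_smul_vec, d_pow_smul_vec, zero_add, zero_add]

theorem isWeightVector_vec (s t : ℕ) :
    IsWeightVector n q (q ^ t * q ^ i) (q⁻¹ ^ s * q ^ j) (vec n q i j s t) := by
  have hq₀ : q ≠ 0 := hq.out.ne_zero (NeZero.ne n)
  rw [vec_eq_smul_vec_zero]
  exact (isWeightVector_vec_zero.a_pow_smul hq₀ t).d_pow_smul hq₀ s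

theorem linearMap_ext_vec {M : Type*} [AddCommGroup M] [Module K M] {f g : P n q i j →ₗ[K] M}
    (h : ∀ s < n, ∀ t < n, f (vec n q i j s t) = g (vec n q i j s t)) : f = g :=
  (basisP n q i j).ext fun x => by rw [basisP_apply, h _ x.1.2 _ x.2.2]

theorem submodule_eq_top_of_vec_mem {W : Submodule K (P n q i j)} (h : vec n q i j 0 0 ∈ W)
    (ha : ∀ s t, vec n q i j s t ∈ W → vec n q i j s (t + 1) ∈ W)
    (hd : ∀ s t, vec n q i j s t ∈ W → vec n q i j (s + 1) t ∈ W) : W = ⊤ := by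
  have hmem (s t : ℕ) : vec n q i j s t ∈ W := by
    induction s with
    | zero =>
      induction t with
      | zero => exact h
      | succ t ih => exact ha 0 t ih
    | succ s ih => exact hd s t ih
  rw [← top_le_iff, ← (basisP n q i j).span_eq, Submodule.span_le]
  rintro _ ⟨x, rfl⟩
  rw [basisP_apply]
  exact hmem _ _

theorem eq_top_of_vec_mem {N : Submodule (TaftTensor K n q) (P n q i j)}
    (h : vec n q i j 0 0 ∈ N) : N = ⊤ := by
  rw [← Submodule.restrictScalars_eq_top_iff K]
  refine submodule_eq_top_of_vec_mem h (fun s t hst => ?_) (fun s t hst => ?_)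
  · rw [← a_smul_vec]
    exact N.smul_mem _ hst
  · rw [← d_smul_vec]
    exact N.smul_mem _ hst

section homP

variable {M : Type*} [AddCommGroup M] [Module K M] [Module (TaftTensor K n q) M]

/-- The linear map `d ^ s a ^ t v ↦ d ^ s a ^ t m`. -/
def linearMapP (i j : ℕ) (m : M) : P n q i j →ₗ[K] M :=
  (basisP n q i j).constr K fun x => d K n q ^ (x.1 : ℕ) • a K n q ^ (x.2 : ℕ) • m

theorem linearMapP_vec (m : M) (s t : ℕ) :
    linearMapP i j m (vec n q i j s t) = d K n q ^ s • a K n q ^ t • m := by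
  obtain hs | hs := le_or_gt n s
  · rw [vec_of_le_left hs, map_zero, pow_eq_zero_of_le hs d_pow, zero_smul]
  obtain ht | ht := le_or_gt n t
  · rw [vec_of_le_right ht, map_zero, pow_eq_zero_of_le ht a_pow, zero_smul, smul_zero]
  rw [← basisP_apply (⟨s, hs⟩, ⟨t, ht⟩), linearMapP, Module.Basis.constr_basis]

variable [IsScalarTower K (TaftTensor K n q) M]

theorem map_smul_of_map_smul_vec (f : P n q i j →ₗ[K] M) (h : TaftTensor K n q)
    (hf : ∀ s t, f (h • vec n q i j s t) = h • f (vec n q i j s t)) (p : P n q i j) :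
    f (h • p) = h • f p :=
  have hcomp : f ∘ₗ Algebra.lsmul K K (P n q i j) h = Algebra.lsmul K K M h ∘ₗ f :=
    linearMap_ext_vec fun s _ t _ => hf s t
  LinearMap.congr_fun hcomp p

/-- The homomorphism from `P i j` taking the generator to a given vector of weight
`(q ^ i, q ^ j)`. -/
def homP {m : M} (hm : IsWeightVector n q (q ^ i) (q ^ j) m) : P n q i j →ₗ[TaftTensor K n q] M :=
  have hq₀ : q ≠ 0 := hq.out.ne_zero (NeZero.ne n)
  have hweight (s t : ℕ) : IsWeightVector n q (q ^ t * q ^ i) (q⁻¹ ^ s * q ^ j)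
      (linearMapP i j m (vec n q i j s t)) := by
    rw [linearMapP_vec]
    exact (hm.a_pow_smul hq₀ t).d_pow_smul hq₀ s
  homOfGenerators (linearMapP i j m)
    (map_smul_of_map_smul_vec _ _ fun s t => by
      rw [a_smul_vec, linearMapP_vec, linearMapP_vec, pow_succ', mul_smul, smul_smul,
        (commute_d_a.pow_left s).eq, mul_smul])
    (map_smul_of_map_smul_vec _ _ fun s t => by
      rw [(isWeightVector_vec s t).b_smul, map_smul, (hweight s t).b_smul])
    (map_smul_of_map_smul_vec _ _ fun s t => by
      rw [(isWeightVector_vec s t).c_smul, map_smul, (hweight s t).c_smul])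
    (map_smul_of_map_smul_vec _ _ fun s t => by
      rw [d_smul_vec, linearMapP_vec, linearMapP_vec, pow_succ', mul_smul])

theorem homP_vec_zero {m : M} (hm : IsWeightVector n q (q ^ i) (q ^ j) m) :
    homP hm (vec n q i j 0 0) = m := by
  refine (linearMapP_vec m 0 0).trans ?_
  rw [pow_zero, pow_zero, one_smul, one_smul]

end homP

instance projective_P : Module.Projective (TaftTensor K n q) (P n q i j) := by
  refine Module.Projective.of_lifting_property'' fun f hf => ?_
  obtain ⟨m, hm, hfm⟩ :=
    (isWeightVector_vec_zero (i := i) (j := j)).exists_lift hq.out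
    (pow_pow_eq_one hq.out.pow_eq_one i) (pow_pow_eq_one hq.out.pow_eq_one j) hf
  refine ⟨homP hm, LinearMap.ext fun p => ?_⟩
  have heq : LinearMap.eqLocus (f ∘ₗ homP hm) LinearMap.id = ⊤ :=
    eq_top_of_vec_mem (by
      rw [LinearMap.mem_eqLocus, LinearMap.comp_apply, homP_vec_zero, hfm, LinearMap.id_apply])
  exact LinearMap.mem_eqLocus.mp (heq ▸ Submodule.mem_top : p ∈ _)

end Projective

end TaftTensor

theorem pow_mul_eq_iff {K : Type*} [Field K] {n : ℕ} {q : K} (hq : IsPrimitiveRoot q n)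
    {t : ℕ} (ht : t < n) {β : K} (hβ : β ≠ 0) : q ^ t * β = β ↔ t = 0 := by
  rw [mul_eq_right₀ hβ]
  exact ⟨fun h => Nat.eq_zero_of_dvd_of_lt (hq.dvd_of_pow_eq_one t h) ht,
    by rintro rfl; exact pow_zero q⟩

namespace TaftTensor

section ProjectiveCover

variable {K : Type u} [Field K] {n : ℕ} {q : K} [NeZero n] [hq : Fact (IsPrimitiveRoot q n)]

variable (n q) in
/-- The coefficient of the generator of `P i j`. -/
def topCoeff (i j : ℕ) : P n q i j →ₗ[K] K := (basisP n q i j).coord (0, 0)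

variable {i j : ℕ}

theorem topCoeff_vec {s t : ℕ} (hs : s < n) (ht : t < n) :
    topCoeff n q i j (vec n q i j s t) = if s = 0 ∧ t = 0 then 1 else 0 := by
  classical
  rw [← basisP_apply (⟨s, hs⟩, ⟨t, ht⟩), topCoeff, Module.Basis.coord_apply,
    Module.Basis.repr_self_apply]
  simp [Prod.ext_iff, Fin.ext_iff]

theorem weightProjector_smul_vec [DecidableEq K] (k l s t : ℕ) :
    weightProjector n q (q ^ k) (q ^ l) • vec n q i j s t =
      if q ^ t * q ^ i = q ^ k ∧ q⁻¹ ^ s * q ^ j = q ^ l then vec n q i j s t else 0 := by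
  have hroot {ζ : K} (hζ : ζ ^ n = 1) (r k : ℕ) : (ζ ^ r * q ^ k) ^ n = 1 := by
    rw [mul_pow, pow_pow_eq_one hζ, pow_pow_eq_one hq.out.pow_eq_one, one_mul]
  exact weightProjector_smul hq.out (pow_pow_eq_one hq.out.pow_eq_one k)
    (pow_pow_eq_one hq.out.pow_eq_one l) (hroot hq.out.pow_eq_one t i)
    (hroot hq.out.inv.pow_eq_one s j) (isWeightVector_vec s t)

theorem weightProjector_smul_P (p : P n q i j) :
    weightProjector n q (q ^ i) (q ^ j) • p = topCoeff n q i j p • vec n q i j 0 0 := by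
  classical
  have h : Algebra.lsmul K K (P n q i j) (weightProjector n q (q ^ i) (q ^ j)) =
      (topCoeff n q i j).smulRight (vec n q i j 0 0) := by
    refine linearMap_ext_vec fun s hs t ht => ?_
    have hq₀ := hq.out.ne_zero (NeZero.ne n)
    rw [LinearMap.smulRight_apply, topCoeff_vec hs ht, Algebra.lsmul_apply,
      weightProjector_smul_vec]
    simp only [pow_mul_eq_iff hq.out ht (pow_ne_zero i hq₀),
      pow_mul_eq_iff hq.out.inv hs (pow_ne_zero j hq₀), and_comm (a := t = 0)]
    split_ifs with h
    · rw [h.1, h.2, one_smul]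
    · rw [zero_smul]
  exact LinearMap.congr_fun h p

variable (n q) in
/-- The projection from `P i j` to its simple quotient. -/
def projP (i j : ℕ) : P n q i j →ₗ[TaftTensor K n q] S K n q i j :=
  homP (isWeightVector_S (unitS q i j))

theorem projP_vec_zero : projP n q i j (vec n q i j 0 0) = unitS q i j := homP_vec_zero _

theorem topCoeff_smul_unitS (p : P n q i j) :
    topCoeff n q i j p • unitS (n := n) q i j = projP n q i j p := by
  classical
  have hπ := congrArg (projP n q i j) (weightProjector_smul_P p)
  rw [map_smul, weightProjector_smul hq.out (pow_pow_eq_one hq.out.pow_eq_one i)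
    (pow_pow_eq_one hq.out.pow_eq_one j) (pow_pow_eq_one hq.out.pow_eq_one i)
    (pow_pow_eq_one hq.out.pow_eq_one j) (isWeightVector_S _), if_pos ⟨rfl, rfl⟩,
    LinearMap.map_smul_of_tower, projP_vec_zero] at hπ
  exact hπ.symm

theorem isProjectiveCover_projP : IsProjectiveCover (projP n q i j) where
  projective := inferInstance
  surjective := LinearMap.surjective_of_ne_zero fun h => unitS_ne_zero (n := n) (q := q) (by
    rw [← projP_vec_zero, h, LinearMap.zero_apply])
  superfluous N hN := by
    obtain ⟨p, hp, k, hk, hpk⟩ := Submodule.mem_sup.mp (hN ▸ Submodule.mem_top :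
      vec n q i j 0 0 ∈ N ⊔ LinearMap.ker (projP n q i j))
    have hcoeff : topCoeff n q i j p = 1 := by
      have h := congrArg (projP n q i j) hpk
      rw [map_add, LinearMap.mem_ker.mp hk, add_zero, projP_vec_zero, ← topCoeff_smul_unitS] at h
      exact smul_left_injective K (unitS_ne_zero (n := n) (q := q)) (h.trans (one_smul K _).symm)
    refine eq_top_of_vec_mem ?_
    rw [← one_smul K (vec n q i j 0 0), ← hcoeff, ← weightProjector_smul_P]
    exact N.smul_mem _ hp

variable (n q) in
/-- The product of `d ^ (n - 1) a ^ (n - 1)`, which sends the head of each `P i j` onto its socle,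
with a weight projector. -/
def headToSocle (β γ : K) : TaftTensor K n q :=
  d K n q ^ (n - 1) * a K n q ^ (n - 1) * weightProjector n q β γ

theorem headToSocle_smul_P (p : P n q i j) :
    headToSocle n q (q ^ i) (q ^ j) • p =
      topCoeff n q i j p • vec n q i j (n - 1) (n - 1) := by
  rw [headToSocle, mul_smul, weightProjector_smul_P, smul_algebra_smul_comm, mul_smul,
    ← vec_eq_smul_vec_zero]

theorem headToSocle_smul_P_of_ne {k l : ℕ} (hi : i < n) (hj : j < n) (hk : k < n) (hl : l < n)
    (h : (i, j) ≠ (k, l)) (p : P n q i j) : headToSocle n q (q ^ k) (q ^ l) • p = 0 := by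
  classical
  have hzero : Algebra.lsmul K K (P n q i j) (headToSocle n q (q ^ k) (q ^ l)) = 0 := by
    refine linearMap_ext_vec fun s _ t _ => ?_
    rw [Algebra.lsmul_apply, headToSocle, mul_smul, weightProjector_smul_vec,
      LinearMap.zero_apply]
    split_ifs with hweight
    · rw [mul_smul, a_pow_smul_vec, d_pow_smul_vec]
      obtain hs | hs := s.eq_zero_or_pos
      · obtain ht | ht := t.eq_zero_or_pos
        · rw [hs, ht, pow_zero, pow_zero, one_mul, one_mul] at hweight
          exact absurd (Prod.ext (hq.out.pow_inj hi hk hweight.1)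
            (hq.out.pow_inj hj hl hweight.2)) h
        · exact vec_of_le_right (by omega)
      · exact vec_of_le_left (by omega)
    · rw [smul_zero]
  exact LinearMap.congr_fun hzero p

theorem headToSocle_smul_S (hn : 1 < n) (β γ : K) (v : S K n q i j) :
    headToSocle n q β γ • v = 0 := by
  rw [headToSocle, mul_smul, mul_smul, ← Nat.sub_add_cancel (Nat.le_sub_one_of_lt hn),
    pow_succ (a K n q), mul_smul, a_smul, smul_zero, smul_zero]

end ProjectiveCover

end TaftTensor

theorem FDMod.eq_top_of_tmul_mem {K H : Type u} [Field K] [Ring H] [Bialgebra K H]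
    {M N : FDMod K H} {T : Submodule H (M.tensor N)} (h : ∀ m w, FDMod.tmul m w ∈ T) : T = ⊤ :=
  eq_top_iff.mpr fun p _ => TensorProduct.induction_on (motive := fun p => (p : M.tensor N) ∈ T) p
    (zero_mem T) h fun _ _ => T.add_mem

theorem sum_range_pow_sub {R : Type*} [Semiring R] {n : ℕ} {y : R} (hy : y ^ n = 1) :
    ∑ s ∈ Finset.range n, y ^ (n - s) = ∑ s ∈ Finset.range n, y ^ s := by
  obtain _ | n := n
  · rfl
  rw [Finset.sum_range_succ', Finset.sum_range_succ', Nat.sub_zero, hy, pow_zero,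
    ← Finset.sum_range_reflect]
  refine congrArg (· + 1) (Finset.sum_congr rfl fun s hs => congrArg (y ^ ·) ?_)
  have := Finset.mem_range.mp hs
  omega

namespace TaftTensor

section Product

variable {K : Type u} [Field K] {n : ℕ} {q : K} [NeZero n] [hq : Fact (IsPrimitiveRoot q n)]

theorem IsWeightVector.tmul {M N : FDMod K (TaftTensor K n q)} {β γ β' γ' : K} {m : M} {w : N}
    (hm : IsWeightVector n q β γ m) (hw : IsWeightVector n q β' γ' w) :
    IsWeightVector n q (β * β') (γ * γ') (FDMod.tmul m w) where
  b_smul := by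
    rw [b_smul_tmul, hm.b_smul, hw.b_smul, LinearMap.map_smul₂, map_smul, smul_smul]
  c_smul := by
    rw [c_smul_tmul, hm.c_smul, hw.c_smul, LinearMap.map_smul₂, map_smul, smul_smul]

variable {i j : ℕ}

theorem tensor_P_eq_top {V : FDMod K (TaftTensor K n q)}
    {T : Submodule (TaftTensor K n q) (V.tensor (P n q i j))}
    (h : ∀ m, FDMod.tmul m (vec n q i j 0 0) ∈ T) : T = ⊤ := by
  let W : Submodule K (P n q i j) := ⨅ m : V, (T.restrictScalars K).comap (FDMod.tmul m)
  have hW {p : P n q i j} : p ∈ W ↔ ∀ m : V, FDMod.tmul m p ∈ T := Submodule.mem_iInf _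
  have htop : W = ⊤ := by
    refine submodule_eq_top_of_vec_mem (hW.mpr h) (fun s t hst => hW.mpr fun m => ?_)
      (fun s t hst => hW.mpr fun m => ?_)
    · have ha := T.smul_mem (a K n q) (hW.mp hst m)
      rw [a_smul_tmul, (isWeightVector_vec s t).b_smul, map_smul, a_smul_vec] at ha
      exact (T.add_mem_iff_right (T.smul_of_tower_mem _ (hW.mp hst _))).mp ha
    · have hd := T.smul_mem (d K n q) (hW.mp hst m)
      rw [d_smul_tmul, (isWeightVector_vec s t).c_smul, map_smul, d_smul_vec] at hd
      exact (T.add_mem_iff_right (T.smul_of_tower_mem _ (hW.mp hst _))).mp hd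
  exact FDMod.eq_top_of_tmul_mem fun m w => hW.mp (htop ▸ Submodule.mem_top) m

theorem greenClass_mul_P {V : FDMod K (TaftTensor K n q)} {ι : Type} [Fintype ι]
    (v : Module.Basis ι K V) {k l : ι → ℕ}
    (hv : ∀ x, IsWeightVector n q (q ^ k x) (q ^ l x) (v x)) (i j : ℕ) :
    greenClass V * greenClass (P n q i j) = ∑ x, greenClass (P n q (k x + i) (l x + j)) := by
  classical
  have hw (x : ι) : IsWeightVector n q (q ^ (k x + i)) (q ^ (l x + j))
      (FDMod.tmul (v x) (vec n q i j 0 0)) := by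
    rw [pow_add, pow_add]
    exact (hv x).tmul isWeightVector_vec_zero
  let f : FDMod.pi (fun x => P n q (k x + i) (l x + j)) →ₗ[TaftTensor K n q] V.tensor (P n q i j) :=
    LinearMap.lsum _ _ ℕ fun x => homP (hw x)
  have hf : Function.Surjective f := by
    refine LinearMap.range_eq_top.mp (tensor_P_eq_top fun m => ?_)
    suffices h : ⊤ ≤ ((LinearMap.range f).restrictScalars K).comap
        (FDMod.tmul.flip (vec n q i j 0 0)) from h (Submodule.mem_top (x := m))
    rw [← v.span_eq, Submodule.span_le]
    rintro _ ⟨x, rfl⟩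
    exact ⟨Pi.single x (vec n q _ _ 0 0), (LinearMap.lsum_piSingle ..).trans (homP_vec_zero _)⟩
  rw [greenClass_mul, ← greenClass_pi, greenClass_eq_of_surjective f hf]
  rw [FDMod.finrank_tensor, finrank_P, Module.finrank_eq_card_basis v]
  refine (Module.finrank_pi_fintype K).trans ?_
  simp only [finrank_P, Finset.sum_const, Finset.card_univ, smul_eq_mul]

theorem greenClass_S_mul_P (i j k l : ℕ) : greenClass (S K n q i j) * greenClass (P n q k l) =
    greenClass (P n q (i + k) (j + l)) := by
  rw [greenClass_mul_P (Module.Basis.singleton Unit K : Module.Basis Unit K (S K n q i j))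
    (fun _ => isWeightVector_S _), Fintype.sum_unique]

theorem greenClass_P_mul_S (i j k l : ℕ) : greenClass (P n q i j) * greenClass (S K n q k l) =
    greenClass (P n q (i + k) (j + l)) := by
  have hq₀ := hq.out.ne_zero (NeZero.ne n)
  have hw : IsWeightVector n q (q ^ (i + k)) (q ^ (j + l))
      (FDMod.tmul (vec n q i j 0 0) (unitS q k l)) := by
    rw [pow_add, pow_add]
    exact isWeightVector_vec_zero.tmul (isWeightVector_S _)
  let T := LinearMap.range (homP hw)
  let W : Submodule K (P n q i j) :=
    (T.restrictScalars K).comap (FDMod.tmul.flip (unitS q k l))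
  have hW : W = ⊤ := by
    refine submodule_eq_top_of_vec_mem (q := q) ⟨_, homP_vec_zero hw⟩ (fun s t hst => ?_)
      (fun s t hst => ?_)
    · have ha := T.smul_mem (a K n q) hst
      rw [LinearMap.flip_apply, a_smul_tmul, b_smul, a_smul, map_smul, map_zero, add_zero,
        a_smul_vec] at ha
      exact ((T.restrictScalars K).smul_mem_iff (pow_ne_zero k hq₀)).mp ha
    · have hd := T.smul_mem (d K n q) hst
      rw [LinearMap.flip_apply, d_smul_tmul, c_smul, d_smul, map_smul, map_zero, add_zero,
        d_smul_vec] at hd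
      exact ((T.restrictScalars K).smul_mem_iff (pow_ne_zero l hq₀)).mp hd
  have hT : T = ⊤ := FDMod.eq_top_of_tmul_mem fun m (w : K) => by
    have hw : w = w • unitS (n := n) q k l := (mul_one w).symm
    have hm : m ∈ W := hW ▸ Submodule.mem_top
    rw [hw, map_smul]
    exact T.smul_of_tower_mem w hm
  rw [greenClass_mul, greenClass_eq_of_surjective (homP hw) (LinearMap.range_eq_top.mp hT)]
  rw [FDMod.finrank_tensor, finrank_P, finrank_P, finrank_S, mul_one]

theorem greenClass_P (i j : ℕ) : greenClass (P n q i j) =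
    greenClass (S K n q 1 0) ^ i * greenClass (S K n q 0 1) ^ j * greenClass (P n q 0 0) := by
  rw [← greenClass_S, greenClass_S_mul_P, add_zero, add_zero]

theorem greenClass_S_one_zero_pow : greenClass (S K n q 1 0) ^ n = 1 := by
  rw [← mul_one (_ ^ n), ← pow_zero (greenClass (S K n q 0 1)), ← greenClass_S,
    greenClass_S_eq_one hq.out.pow_eq_one (pow_zero q), pow_zero]

theorem greenClass_S_zero_one_pow : greenClass (S K n q 0 1) ^ n = 1 := by
  rw [← one_mul (_ ^ n), ← pow_zero (greenClass (S K n q 1 0)), ← greenClass_S,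
    greenClass_S_eq_one (pow_zero q) hq.out.pow_eq_one, pow_zero]

theorem greenClass_P_sq : greenClass (P n q 0 0) ^ 2 =
    ∑ i ∈ Finset.range n, ∑ j ∈ Finset.range n,
      greenClass (S K n q 1 0) ^ i * greenClass (S K n q 0 1) ^ j * greenClass (P n q 0 0) := by
  have hbasis (x : Fin n × Fin n) :
      IsWeightVector n q (q ^ (x.2 : ℕ)) (q ^ (n - x.1 : ℕ)) (basisP n q 0 0 x) := by
    have hinv : q ^ (n - x.1 : ℕ) = q⁻¹ ^ (x.1 : ℕ) := by
      rw [pow_sub₀ q (hq.out.ne_zero (NeZero.ne n)) x.1.2.le, hq.out.pow_eq_one, one_mul, inv_pow]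
    have hvec := isWeightVector_vec (n := n) (q := q) (i := 0) (j := 0) x.1 x.2
    rwa [← hinv, pow_zero, mul_one, mul_one, ← basisP_apply] at hvec
  rw [sq, greenClass_mul_P (basisP n q 0 0) hbasis, Fintype.sum_prod_type_right,
    ← Fin.sum_univ_eq_sum_range]
  refine Finset.sum_congr rfl fun t _ => ?_
  rw [← Finset.sum_mul, ← Finset.mul_sum, ← sum_range_pow_sub greenClass_S_zero_one_pow,
    ← Fin.sum_univ_eq_sum_range (fun s => _ ^ (n - s)), Finset.mul_sum, Finset.sum_mul]
  exact Finset.sum_congr rfl fun s _ => greenClass_P ..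

end Product

section ProjectiveClass

variable {K : Type u} [Field K] {n : ℕ} {q : K} [NeZero n] [hq : Fact (IsPrimitiveRoot q n)]

theorem exists_surjective_P (M : FDMod K (TaftTensor K n q)) [Nontrivial M]
    [Module.Projective (TaftTensor K n q) M] :
    ∃ i < n, ∃ j < n, ∃ f : M →ₗ[TaftTensor K n q] P n q i j, Function.Surjective f := by
  have : Module.Finite (TaftTensor K n q) M := Module.Finite.of_restrictScalars_finite K _ M
  obtain ⟨N, hN, -⟩ := (eq_top_or_exists_le_coatom
    (⊥ : Submodule (TaftTensor K n q) M)).resolve_left bot_ne_top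
  have : IsSimpleModule (TaftTensor K n q) (FDMod.ofQuotient N) :=
    isSimpleModule_iff_isCoatom.mpr hN
  obtain ⟨i, hi, j, hj, ⟨e⟩⟩ := exists_equiv_S (FDMod.ofQuotient N)
  have hτ : Function.Surjective (e.symm.toLinearMap ∘ₗ (N.mkQ : M →ₗ[_] FDMod.ofQuotient N)) :=
    e.symm.surjective.comp N.mkQ_surjective
  exact ⟨i, hi, j, hj, isProjectiveCover_projP.exists_surjective hτ⟩

theorem greenClass_mem_of_projective {T : AddSubgroup (GreenRing K (TaftTensor K n q))}
    (hT : ∀ i < n, ∀ j < n, greenClass (P n q i j) ∈ T) (M : FDMod K (TaftTensor K n q))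
    [Module.Projective (TaftTensor K n q) M] : greenClass M ∈ T := by
  induction hd : Module.finrank K M using Nat.strong_induction_on generalizing M with
  | h r ih =>
    obtain _ | _ := subsingleton_or_nontrivial M
    · rw [greenClass_of_subsingleton]
      exact zero_mem T
    · obtain ⟨i, hi, j, hj, f, hf⟩ := exists_surjective_P M
      let N := FDMod.ofSubmodule (LinearMap.ker f)
      obtain ⟨e⟩ : Nonempty (M ≃ₗ[TaftTensor K n q] N × P n q i j) :=
        nonempty_equiv_ker_prod_of_surjective f hf
      have hN : Module.Projective (TaftTensor K n q) N :=
        Module.Projective.of_split (e.symm.toLinearMap ∘ₗ LinearMap.inl ..)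
          (LinearMap.fst .. ∘ₗ e.toLinearMap) (LinearMap.ext fun v => by
            simp only [LinearMap.comp_apply, LinearEquiv.coe_coe, LinearEquiv.apply_symm_apply,
              LinearMap.inl_apply, LinearMap.fst_apply, LinearMap.id_apply])
      have hlt : Module.finrank K N < r := by
        have hrank := (e.restrictScalars K).finrank_eq
        rw [hd, Module.finrank_prod, finrank_P] at hrank
        have hpos := Nat.mul_pos (NeZero.pos n) (NeZero.pos n)
        omega
      rw [greenClass_eq_ker_add f hf]
      exact add_mem (ih _ hlt N rfl) (hT i hi j hj)

theorem greenRank_headToSocle_S (hn : 1 < n) (β γ : K) (i j : ℕ) :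
    greenRank (headToSocle n q β γ) (greenClass (S K n q i j)) = 0 :=
  greenRank_eq_zero (headToSocle_smul_S hn β γ)

theorem greenRank_headToSocle_P (x y : Fin n × Fin n) :
    greenRank (headToSocle n q (q ^ (y.1 : ℕ)) (q ^ (y.2 : ℕ))) (greenClass (P n q x.1 x.2)) =
      if x = y then 1 else 0 := by
  split_ifs with hxy
  · have hrep : (P n q x.1 x.2).rep (headToSocle n q (q ^ (x.1 : ℕ)) (q ^ (x.2 : ℕ))) =
        (topCoeff n q x.1 x.2).smulRight (vec n q x.1 x.2 (n - 1) (n - 1)) :=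
      LinearMap.ext headToSocle_smul_P
    have hcoeff : topCoeff n q x.1 x.2 ≠ 0 := fun h => by
      have hone := topCoeff_vec (q := q) (i := x.1) (j := x.2) (NeZero.pos n) (NeZero.pos n)
      rw [h, LinearMap.zero_apply, if_pos ⟨rfl, rfl⟩] at hone
      exact zero_ne_one hone
    have hsocle : vec n q x.1 x.2 (n - 1) (n - 1) ≠ 0 := by
      have hlt : n - 1 < n := Nat.sub_one_lt (NeZero.ne n)
      rw [← basisP_apply (⟨n - 1, hlt⟩, ⟨n - 1, hlt⟩)]
      exact (basisP n q x.1 x.2).ne_zero _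
    rw [← hxy, greenRank_greenClass, hrep, LinearMap.range_smulRight_apply hcoeff,
      finrank_span_singleton hsocle, Nat.cast_one]
  · exact greenRank_eq_zero (headToSocle_smul_P_of_ne x.1.2 x.2.2 y.1.2 y.2.2 fun h =>
      hxy (Prod.ext (Fin.ext (congrArg Prod.fst h)) (Fin.ext (congrArg Prod.snd h))))

theorem greenRank_weightProjector_S (x y : Fin n × Fin n) :
    greenRank (weightProjector n q (q ^ (y.1 : ℕ)) (q ^ (y.2 : ℕ)))
      (greenClass (S K n q x.1 x.2)) = if x = y then 1 else 0 := by
  classical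
  have hroot (i : ℕ) : (q ^ i) ^ n = 1 := pow_pow_eq_one hq.out.pow_eq_one i
  have hsmul (v : S K n q x.1 x.2) :
      weightProjector n q (q ^ (y.1 : ℕ)) (q ^ (y.2 : ℕ)) • v = if x = y then v else 0 := by
    have hweight : q ^ (x.1 : ℕ) = q ^ (y.1 : ℕ) ∧ q ^ (x.2 : ℕ) = q ^ (y.2 : ℕ) ↔ x = y :=
      ⟨fun h => Prod.ext (Fin.ext (hq.out.pow_inj x.1.2 y.1.2 h.1))
        (Fin.ext (hq.out.pow_inj x.2.2 y.2.2 h.2)), by rintro rfl; exact ⟨rfl, rfl⟩⟩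
    rw [weightProjector_smul hq.out (hroot _) (hroot _) (hroot _) (hroot _) (isWeightVector_S v),
      if_congr hweight rfl rfl]
  split_ifs with hxy
  · have hrep : (S K n q x.1 x.2).rep
        (weightProjector n q (q ^ (y.1 : ℕ)) (q ^ (y.2 : ℕ))) = 1 :=
      LinearMap.ext fun v => (hsmul v).trans (if_pos hxy)
    rw [greenRank_greenClass, hrep, Module.End.one_eq_id, LinearMap.range_id, finrank_top,
      finrank_S, Nat.cast_one]
  · exact greenRank_eq_zero fun v => (hsmul v).trans (if_neg hxy)

variable (K n q) in
/-- The classes of the simple modules, followed by those of their projective covers. -/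
def simpleProjectiveClass : (Fin n × Fin n) ⊕ (Fin n × Fin n) → GreenRing K (TaftTensor K n q) :=
  Sum.elim (fun x => greenClass (S K n q x.1 x.2)) fun x => greenClass (P n q x.1 x.2)

theorem linearIndependent_simpleProjectiveClass (hn : 1 < n) :
    LinearIndependent ℤ (simpleProjectiveClass K n q) := by
  rw [Fintype.linearIndependent_iff]
  intro r hr
  simp only [Fintype.sum_sum_type, simpleProjectiveClass, Sum.elim_inl, Sum.elim_inr] at hr
  have hP (y : Fin n × Fin n) : r (.inr y) = 0 := by
    have h := congrArg (greenRank (headToSocle n q (q ^ (y.1 : ℕ)) (q ^ (y.2 : ℕ)))) hr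
    simpa only [map_add, map_sum, map_zsmul, greenRank_headToSocle_S hn, smul_zero,
      smul_eq_mul, mul_ite, mul_one, mul_zero, Finset.sum_const_zero, zero_add,
      Finset.sum_ite_eq', Finset.mem_univ, if_true, map_zero, greenRank_headToSocle_P] using h
  have hS (y : Fin n × Fin n) : r (.inl y) = 0 := by
    have h := congrArg (greenRank (weightProjector n q (q ^ (y.1 : ℕ)) (q ^ (y.2 : ℕ)))) hr
    simpa only [hP, zero_smul, Finset.sum_const_zero, add_zero, map_sum, map_zsmul,
      smul_eq_mul, mul_ite, mul_one, mul_zero,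
      Finset.sum_ite_eq', Finset.mem_univ, if_true, map_zero, greenRank_weightProjector_S] using h
  exact Sum.rec hS hP

end ProjectiveClass

end TaftTensor

section Presentation

/-- The elements `u 0`, `u 1`, `u 2` satisfy the relations generating `presentationIdeal n`. -/
structure SatisfiesPresentation {R : Type*} [Semiring R] (n : ℕ) (u : Fin 3 → R) : Prop where
  zero_pow : u 0 ^ n = 1
  one_pow : u 1 ^ n = 1
  two_sq : u 2 ^ 2 = ∑ i ∈ Finset.range n, ∑ j ∈ Finset.range n, u 0 ^ i * u 1 ^ j * u 2

/-- The normal forms `x ^ i y ^ j` and `x ^ i y ^ j z` with `i, j < n`, evaluated at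
`(x, y, z) = (u 0, u 1, u 2)`. -/
def presentationMonomial {R : Type*} [Semiring R] (n : ℕ) (u : Fin 3 → R) :
    (Fin n × Fin n) ⊕ (Fin n × Fin n) → R :=
  Sum.elim (fun x => u 0 ^ (x.1 : ℕ) * u 1 ^ (x.2 : ℕ))
    fun x => u 0 ^ (x.1 : ℕ) * u 1 ^ (x.2 : ℕ) * u 2

theorem map_presentationMonomial {R R' : Type*} [Semiring R] [Semiring R'] (θ : R →+* R') {n : ℕ}
    (u : Fin 3 → R) (x : (Fin n × Fin n) ⊕ (Fin n × Fin n)) :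
    θ (presentationMonomial n u x) = presentationMonomial n (fun k => θ (u k)) x := by
  obtain x | x := x <;>
    simp only [presentationMonomial, Sum.elim_inl, Sum.elim_inr, map_mul, map_pow]

theorem presentationIdeal_le_ker_iff {R : Type*} [Ring R] {n : ℕ}
    {ψ : MvPolynomial (Fin 3) ℤ →+* R} :
    presentationIdeal n ≤ RingHom.ker ψ ↔
      SatisfiesPresentation n fun k => ψ (MvPolynomial.X k) := by
  rw [presentationIdeal, Ideal.span_le]
  simp only [Set.insert_subset_iff, Set.singleton_subset_iff, SetLike.mem_coe, RingHom.mem_ker,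
    map_sub, map_pow, map_one, map_sum, map_mul, sub_eq_zero]
  exact ⟨fun h => ⟨h.1, h.2.1, h.2.2⟩, fun h => ⟨h.zero_pow, h.one_pow, h.two_sq⟩⟩

theorem satisfiesPresentation_mk (n : ℕ) : SatisfiesPresentation n fun k =>
    Ideal.Quotient.mk (presentationIdeal n) (MvPolynomial.X k) :=
  presentationIdeal_le_ker_iff.mp Ideal.mk_ker.ge

namespace SatisfiesPresentation

variable {R : Type*} [CommRing R] {n : ℕ} [NeZero n] {u : Fin 3 → R}

theorem pow_mul_pow_mem_span (h : SatisfiesPresentation n u) (i j : ℕ) :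
    u 0 ^ i * u 1 ^ j ∈ Submodule.span ℤ (Set.range (presentationMonomial n u)) := by
  rw [pow_eq_pow_mod i h.zero_pow, pow_eq_pow_mod j h.one_pow]
  exact Submodule.subset_span
    ⟨.inl (⟨_, i.mod_lt (NeZero.pos n)⟩, ⟨_, j.mod_lt (NeZero.pos n)⟩), rfl⟩

theorem pow_mul_pow_mul_mem_span (h : SatisfiesPresentation n u) (i j : ℕ) :
    u 0 ^ i * u 1 ^ j * u 2 ∈ Submodule.span ℤ (Set.range (presentationMonomial n u)) := by
  rw [pow_eq_pow_mod i h.zero_pow, pow_eq_pow_mod j h.one_pow]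
  exact Submodule.subset_span
    ⟨.inr (⟨_, i.mod_lt (NeZero.pos n)⟩, ⟨_, j.mod_lt (NeZero.pos n)⟩), rfl⟩

theorem presentationMonomial_mul_mem_span (h : SatisfiesPresentation n u)
    (x : (Fin n × Fin n) ⊕ (Fin n × Fin n)) (k : Fin 3) :
    presentationMonomial n u x * u k ∈
      Submodule.span ℤ (Set.range (presentationMonomial n u)) := by
  match x, k with
  | .inl (i, j), 0 =>
    convert h.pow_mul_pow_mem_span (i + 1) j using 1
    rw [presentationMonomial, Sum.elim_inl]
    ring
  | .inl (i, j), 1 =>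
    convert h.pow_mul_pow_mem_span i (j + 1) using 1
    rw [presentationMonomial, Sum.elim_inl]
    ring
  | .inl (i, j), 2 => exact h.pow_mul_pow_mul_mem_span i j
  | .inr (i, j), 0 =>
    convert h.pow_mul_pow_mul_mem_span (i + 1) j using 1
    rw [presentationMonomial, Sum.elim_inr]
    ring
  | .inr (i, j), 1 =>
    convert h.pow_mul_pow_mul_mem_span i (j + 1) using 1
    rw [presentationMonomial, Sum.elim_inr]
    ring
  | .inr (i, j), 2 =>
    change u 0 ^ (i : ℕ) * u 1 ^ (j : ℕ) * u 2 * u 2 ∈ _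
    rw [mul_assoc, ← sq, h.two_sq]
    simp only [Finset.mul_sum]
    refine Submodule.sum_mem _ fun s _ => Submodule.sum_mem _ fun t _ => ?_
    convert h.pow_mul_pow_mul_mem_span (i + s) (j + t) using 1
    ring

theorem mul_mem_span (h : SatisfiesPresentation n u) {r : R}
    (hr : r ∈ Submodule.span ℤ (Set.range (presentationMonomial n u)))
    (k : Fin 3) : r * u k ∈ Submodule.span ℤ (Set.range (presentationMonomial n u)) := by
  have hle : Submodule.span ℤ (Set.range (presentationMonomial n u)) ≤
      (Submodule.span ℤ (Set.range (presentationMonomial n u))).comap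
        (LinearMap.mulRight ℤ (u k)) := by
    rw [Submodule.span_le]
    rintro _ ⟨x, rfl⟩
    exact h.presentationMonomial_mul_mem_span x k
  exact hle hr

end SatisfiesPresentation

theorem span_presentationMonomial_mk (n : ℕ) [NeZero n] :
    Submodule.span ℤ (Set.range (presentationMonomial n fun k =>
      Ideal.Quotient.mk (presentationIdeal n) (MvPolynomial.X k))) = ⊤ := by
  have h := satisfiesPresentation_mk n
  refine eq_top_iff.mpr fun r _ => ?_
  obtain ⟨p, rfl⟩ := Ideal.Quotient.mk_surjective r
  induction p using MvPolynomial.induction_on with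
  | C r =>
    have hone := Submodule.smul_mem _ r (h.pow_mul_pow_mem_span 0 0)
    rwa [pow_zero, pow_zero, mul_one, zsmul_one, ← map_intCast
      ((Ideal.Quotient.mk (presentationIdeal n)).comp MvPolynomial.C), Int.cast_id] at hone
  | add p p' hp hp' =>
    rw [map_add]
    exact add_mem (hp trivial) (hp' trivial)
  | mul_X p k hp =>
    rw [map_mul]
    exact h.mul_mem_span (hp trivial) k

theorem exists_ringHom_closure_of_pairwise_commute {R σ : Type*} [Ring R] {u : σ → R}
    (hu : Pairwise fun k l => Commute (u k) (u l)) :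
    ∃ ψ : MvPolynomial σ ℤ →+* Subring.closure (Set.range u),
      ∀ k, (ψ (MvPolynomial.X k) : R) = u k := by
  have hcomm : IsMulCommutative (Subring.closure (Set.range u)) :=
    Subring.isMulCommutative_closure (by
      rintro _ ⟨k, rfl⟩ _ ⟨l, rfl⟩
      obtain rfl | hkl := eq_or_ne k l
      exacts [rfl, hu hkl])
  let _ : CommRing (Subring.closure (Set.range u)) :=
    { (inferInstance : Ring (Subring.closure (Set.range u))) with
      mul_comm := hcomm.is_comm.comm }
  let ψ : MvPolynomial σ ℤ →+* Subring.closure (Set.range u) :=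
    MvPolynomial.eval₂Hom (Int.castRingHom _)
      fun k => ⟨u k, Subring.subset_closure (Set.mem_range_self k)⟩
  exact ⟨ψ, fun k => congrArg Subtype.val (MvPolynomial.eval₂Hom_X' ..)⟩

theorem injective_of_span_eq_top_of_linearIndependent {R M N ι : Type*} [Ring R] [AddCommGroup M]
    [Module R M] [AddCommGroup N] [Module R N] {v : ι → M}
    (hv : Submodule.span R (Set.range v) = ⊤) {f : M →ₗ[R] N} (hf : LinearIndependent R (f ∘ v)) :
    Function.Injective f := by
  rw [← LinearMap.ker_eq_bot, ← top_disjoint, ← hv]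
  exact Submodule.range_ker_disjoint hf

theorem SatisfiesPresentation.exists_ringEquiv_closure {R : Type*} [Ring R] {n : ℕ} [NeZero n]
    {u : Fin 3 → R} (h : SatisfiesPresentation n u) (hu : Pairwise fun k l => Commute (u k) (u l))
    (hli : LinearIndependent ℤ (presentationMonomial n u)) :
    ∃ e : (MvPolynomial (Fin 3) ℤ ⧸ presentationIdeal n) ≃+* Subring.closure (Set.range u),
      ∀ k, (e (Ideal.Quotient.mk _ (MvPolynomial.X k)) : R) = u k := by
  obtain ⟨ψ, hψ⟩ := exists_ringHom_closure_of_pairwise_commute hu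
  have hle : presentationIdeal n ≤ RingHom.ker ψ := by
    rw [← RingHom.ker_comp_of_injective (g := ψ) (f := (Subring.closure (Set.range u)).subtype)
      Subtype.val_injective, presentationIdeal_le_ker_iff]
    convert h
    exact hψ _
  let φ := Ideal.Quotient.lift (presentationIdeal n) ψ hle
  let θ := (Subring.closure (Set.range u)).subtype.comp φ
  have hθ (k : Fin 3) : θ (Ideal.Quotient.mk _ (MvPolynomial.X k)) = u k := hψ k
  have hmonomial : θ ∘ presentationMonomial n (fun k =>
      Ideal.Quotient.mk (presentationIdeal n) (MvPolynomial.X k)) = presentationMonomial n u := by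
    ext x
    rw [Function.comp_apply, map_presentationMonomial, funext hθ]
  have hinj : Function.Injective θ :=
    injective_of_span_eq_top_of_linearIndependent (span_presentationMonomial_mk n)
      (f := θ.toAddMonoidHom.toIntLinearMap) (hmonomial ▸ hli)
  have hsurj : Function.Surjective φ := fun ⟨r, hr⟩ => by
    have hrange : Subring.closure (Set.range u) ≤ θ.range := by
      rw [Subring.closure_le]
      rintro _ ⟨k, rfl⟩
      exact ⟨_, hθ k⟩
    obtain ⟨p, hp⟩ := hrange hr
    exact ⟨p, Subtype.ext hp⟩
  exact ⟨RingEquiv.ofBijective φ ⟨hinj.of_comp (f := Subtype.val), hsurj⟩, hθ⟩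

end Presentation

namespace TaftTensor

section Generators

variable {K : Type u} [Field K] {n : ℕ} {q : K} [NeZero n] [hq : Fact (IsPrimitiveRoot q n)]

variable (K n q) in
/-- The classes `[S 1 0]`, `[S 0 1]` and `[P 0 0]`, which generate the projective class ring. -/
def generator : Fin 3 → GreenRing K (TaftTensor K n q) :=
  ![greenClass (S K n q 1 0), greenClass (S K n q 0 1), greenClass (P n q 0 0)]

theorem satisfiesPresentation_generator : SatisfiesPresentation n (generator K n q) :=
  ⟨greenClass_S_one_zero_pow, greenClass_S_zero_one_pow, greenClass_P_sq⟩

theorem presentationMonomial_generator :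
    presentationMonomial n (generator K n q) = simpleProjectiveClass K n q := by
  ext (x | x)
  · exact (greenClass_S ..).symm
  · exact (greenClass_P ..).symm

theorem pairwise_commute_generator :
    Pairwise fun k l => Commute (generator K n q k) (generator K n q l) := by
  have h01 : Commute (greenClass (S K n q 1 0)) (greenClass (S K n q 0 1)) := by
    rw [commute_iff_eq, greenClass_S_mul_S, greenClass_S_mul_S]
  have h02 : Commute (greenClass (S K n q 1 0)) (greenClass (P n q 0 0)) := by
    rw [commute_iff_eq, greenClass_S_mul_P, greenClass_P_mul_S]
  have h12 : Commute (greenClass (S K n q 0 1)) (greenClass (P n q 0 0)) := by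
    rw [commute_iff_eq, greenClass_S_mul_P, greenClass_P_mul_S]
  intro k l hkl
  fin_cases k <;> fin_cases l
  exacts [absurd rfl hkl, h01, h02, h01.symm, absurd rfl hkl, h12, h02.symm, h12.symm,
    absurd rfl hkl]

theorem closure_range_generator :
    Subring.closure (Set.range (generator K n q)) = projectiveClassRing K (TaftTensor K n q) := by
  have hgen (k : Fin 3) : generator K n q k ∈ Subring.closure (Set.range (generator K n q)) :=
    Subring.subset_closure (Set.mem_range_self k)
  have hS (i j : ℕ) :
      greenClass (S K n q i j) ∈ Subring.closure (Set.range (generator K n q)) := by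
    rw [greenClass_S]
    exact mul_mem (pow_mem (hgen 0) i) (pow_mem (hgen 1) j)
  apply le_antisymm <;> refine Subring.closure_le.mpr ?_
  · rintro _ ⟨k, rfl⟩
    apply Subring.subset_closure
    fin_cases k
    exacts [⟨_, .inr inferInstance, rfl⟩, ⟨_, .inr inferInstance, rfl⟩,
      ⟨_, .inl inferInstance, rfl⟩]
  · rintro _ ⟨M, hM | hM, rfl⟩
    · refine greenClass_mem_of_projective (T := (Subring.closure _).toAddSubgroup)
        (fun i _ j _ => ?_) M
      rw [greenClass_P, ← greenClass_S]
      exact Subring.mul_mem _ (hS i j) (hgen 2)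
    · obtain ⟨i, -, j, -, ⟨e⟩⟩ := exists_equiv_S M
      rw [← greenClass_congr e]
      exact hS i j

end Generators

end TaftTensor

end

theorem theorem3p8_general {K : Type*} [Field K] (n : ℕ) [NeZero n] (hn : 1 < n)
    (q : K) [Fact (IsPrimitiveRoot q n)] :
    ∃ e : (MvPolynomial (Fin 3) ℤ ⧸ presentationIdeal n) ≃+*
        projectiveClassRing K (TaftTensor K n q),
      (e (Ideal.Quotient.mk _ (MvPolynomial.X 0)) : GreenRing K (TaftTensor K n q)) =
          greenClass (TaftTensor.S K n q 1 0) ∧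
      (e (Ideal.Quotient.mk _ (MvPolynomial.X 1)) : GreenRing K (TaftTensor K n q)) =
          greenClass (TaftTensor.S K n q 0 1) ∧
      (∃ (P : FDMod K (TaftTensor K n q))
          (π : P →ₗ[TaftTensor K n q] TaftTensor.S K n q 0 0), IsProjectiveCover π) ∧
      ∀ (P : FDMod K (TaftTensor K n q)) (π : P →ₗ[TaftTensor K n q] TaftTensor.S K n q 0 0),
        IsProjectiveCover π →
          (e (Ideal.Quotient.mk _ (MvPolynomial.X 2)) : GreenRing K (TaftTensor K n q)) =
            greenClass P := by
  have hli : LinearIndependent ℤ (presentationMonomial n (TaftTensor.generator K n q)) := by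
    rw [TaftTensor.presentationMonomial_generator]
    exact TaftTensor.linearIndependent_simpleProjectiveClass hn
  have hpresentation := TaftTensor.satisfiesPresentation_generator.exists_ringEquiv_closure
    TaftTensor.pairwise_commute_generator hli
  rw [TaftTensor.closure_range_generator] at hpresentation
  obtain ⟨e, he⟩ := hpresentation
  refine ⟨e, he 0, he 1, ⟨_, _, TaftTensor.isProjectiveCover_projP⟩, fun P π hπ => ?_⟩
  exact (he 2).trans (TaftTensor.isProjectiveCover_projP.greenClass_eq hπ)

theorem theorem3p8 {K : Type*} [Field K] [IsAlgClosed K] (n : ℕ) [NeZero n] (hn : 2 < n)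
    (q : K) [Fact (IsPrimitiveRoot q n)] :
    ∃ e : (MvPolynomial (Fin 3) ℤ ⧸ presentationIdeal n) ≃+*
        projectiveClassRing K (TaftTensor K n q),
      (e (Ideal.Quotient.mk _ (MvPolynomial.X 0)) : GreenRing K (TaftTensor K n q)) =
          greenClass (TaftTensor.S K n q 1 0) ∧
      (e (Ideal.Quotient.mk _ (MvPolynomial.X 1)) : GreenRing K (TaftTensor K n q)) =
          greenClass (TaftTensor.S K n q 0 1) ∧
      (∃ (P : FDMod K (TaftTensor K n q))
          (π : P →ₗ[TaftTensor K n q] TaftTensor.S K n q 0 0), IsProjectiveCover π) ∧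
      ∀ (P : FDMod K (TaftTensor K n q)) (π : P →ₗ[TaftTensor K n q] TaftTensor.S K n q 0 0),
        IsProjectiveCover π →
          (e (Ideal.Quotient.mk _ (MvPolynomial.X 2)) : GreenRing K (TaftTensor K n q)) =
            greenClass P :=
  theorem3p8_general n (by omega) q
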